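/- Let $n\ge 1$, $q\in\mathbb{C}^*$ with $|q|<1$, and let $s=(s_1,\dots,s_n)\in(\mathbb{C}^*)^n$ satisfy $s_j/s_i\notin q^{\mathbb{Z}\setminus\{0\}}$ for $1\le i<j\le n$. Write $$(z;p)_\infty=\prod_{i\ge0}(1-p^iz),\quad (z;p,q)_\infty=\prod_{i,j\ge0}(1-p^iq^jz),\quad \theta(z;p)=(z;p)_\infty(p/z;p)_\infty,\quad \Gamma(z;p,q)=\frac{(pq/z;p,q)_\infty}{(z;p,q)_\infty}.$$ Let $R=\mathbb{C}[[px_1/x_n,\,x_2/x_1,\,\dots,\,x_n/x_{n-1}]]$ be the ring of formal power series in the $n$ variables $z_0=px_1/x_n$, $z_i=x_{i+1}/x_i$ $(1\le i\le n-1)$; it contains $\mathbb{C}[[p]]$ through $p=z_0z_1\cdots z_{n-1}$. For $t\in\mathbb{C}^*$ and $1\le r\le n$ let $$\mathcal{E}^{(r)}_{x,s}(p|q,t)=\sum_{I\subseteq\{1,\dots,n\},\,|I|=r}\Big(\prod_{i\in I}s_i\Big)\prod_{\substack{i<j\\ i\in I,\,j\notin I}}\frac{\theta(x_j/tx_i;p)}{\theta(x_j/x_i;p)}\prod_{\substack{i<j\\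 i\notin I,\,j\in I}}\frac{\theta(tx_j/x_i;p)}{\theta(x_j/x_i;p)}\prod_{i\in I}T_{q,x_i}$$ be the modified elliptic Ruijsenaars operators acting on $R$, where $T_{q,x_i}$ replaces $x_i$ by $qx_i$ and fixes $p$. A normalized Ruijsenaars function for $(q,t)$ with eigenvalues $\varepsilon^{(r)}(s;p|q,t)\in\mathbb{C}[[p]]$ is an $f=f(x;s;p|q,t)\in R$ such that $\mathcal{E}^{(r)}_{x,s}(p|q,t)f=\varepsilon^{(r)}(s;p|q,t)f$ for $r=1,\dots,n$ and such that the constant term of $f$ with respect to $x$ is $1$, i.e. the coefficient of $(z_0z_1\cdots z_{n-1})^m$ in $f$ is $\delta_{m,0}$ for all $m\ge0$. Then there are power series $\gamma(s;p|q,t)\in\mathbb{C}[[p]]$ $(t\in\mathbb{C}^*)$, independent of $x$, with $$\gamma(s;p|q,t)\,\gamma(s;p|q,q/t)=1\qquad(t\in\mathbb{C}^*),$$ such that, for every $t\in\mathbb{C}^*$ and every normalized Ruijsenaars function $f(x;s;p|q,t)$ for $(q,t)$ with eigenvalues $\varepsilon^{(r)}(s;p|q,t)$, the following hold. 1. There is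 exactly one normalized Ruijsenaars function $f(x;s;p|q,q/t)$ for $(q,q/t)$, and in $R$ $$f(x;s;p|q,q/t)=\gamma(s;p|q,t)\prod_{1\le i<j\le n}\frac{\Gamma(tx_j/x_i;p,q)}{\Gamma(qx_j/tx_i;p,q)}\cdot f(x;s;p|q,t).$$ 2. The eigenvalues are invariant under the reflection $t\leftrightarrow q/t$: they are uniquely determined for $(q,q/t)$, and $\varepsilon^{(r)}(s;p|q,q/t)=\varepsilon^{(r)}(s;p|q,t)$ for $r=1,\dots,n$. 3. If the power series $f(x;s;p|q,t)$ converges absolutely in a neighbourhood of $z_0=\dots=z_{n-1}=0$, then there is $\sigma\in(0,1)$, not depending on $p$, such that for all $p\in\mathbb{C}$ and $x\in(\mathbb{C}^*)^n$ with $|px_1/x_n|<\sigma$, $|x_2/x_1|<\sigma,\dots,|x_n/x_{n-1}|<\sigma$ the series $f(x;s;p|q,t)$, $f(x;s;p|q,q/t)$ and $\gamma(s;p|q,t)$ converge absolutely, and the identity in 1 holds between their values. -/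

import Mathlib

namespace Ruijsenaars

noncomputable section

/-! ### Infinite products

The shifted factorials make sense in every topological commutative ring. They are used in `ℂ` and in
the ring of formal power series over `ℂ` (topology of coefficientwise convergence). -/

/-- `(z; p)_∞ = ∏_{i ≥ 0} (1 - p ^ i z)`. -/
def shiftedFactorial {A : Type*} [CommRing A] [TopologicalSpace A] (p z : A) : A :=
  ∏' i : ℕ, (1 - p ^ i * z)

/-- `(z; p, q)_∞ = ∏_{i, j ≥ 0} (1 - p ^ i q ^ j z)`. -/
def doubleShiftedFactorial {A : Type*} [CommRing A] [TopologicalSpace A] (p q z : A) : A :=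
  ∏' k : ℕ × ℕ, (1 - p ^ k.1 * q ^ k.2 * z)

/-- The elliptic gamma function `Γ(z; p, q) = (pq / z; p, q)_∞ / (z; p, q)_∞` of a complex variable. -/
def ellipticGamma (p q z : ℂ) : ℂ :=
  doubleShiftedFactorial p q (p * q / z) / doubleShiftedFactorial p q z

/-! ### The ring `ℂ⟦p x₁ / x_n, x₂ / x₁, …, x_n / x_{n-1}⟧`

The position variables are `x₀, …, x_{n-1}` and the variable `X j` stands for `z_j = x_j / x_{j-1}`
if `j ≠ 0`, and `X 0` for `z_0 = p x₀ / x_{n-1}`. The nome `p` is the product of all `z_j`. -/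

/-- Formal power series in `z_0, …, z_{n-1}`. -/
abbrev Series (n : ℕ) : Type := MvPowerSeries (Fin n) ℂ

variable {n : ℕ}

/-- The nome `p = z_0 z_1 ⋯ z_{n-1}`. -/
def nome (n : ℕ) : Series n := ∏ m : Fin n, MvPowerSeries.X m

/-- The monomial `x_j / x_i = z_{i+1} ⋯ z_j`, for `i < j`. -/
def ratio (i j : Fin n) : Series n := ∏ m ∈ Finset.Ioc i j, MvPowerSeries.X m

/-- The monomial `p x_i / x_j`, for `i < j`: the product of the `z_m` that do not occur
in `x_j / x_i`. -/
def coratio (i j : Fin n) : Series n := ∏ m ∈ (Finset.Ioc i j)ᶜ, MvPowerSeries.X m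

/-- A power series in `p`, regarded as a power series in `z_0, …, z_{n-1}`. -/
def ofNome (n : ℕ) (g : PowerSeries ℂ) : Series n := PowerSeries.subst (nome n) g

open scoped MvPowerSeries.WithPiTopology in
/-- The expansion of `θ(c x_j / x_i; p) = (c x_j / x_i; p)_∞ (p x_i / (c x_j); p)_∞`, for `i < j`. -/
def formalTheta (c : ℂ) (i j : Fin n) : Series n :=
  shiftedFactorial (nome n) (MvPowerSeries.C c * ratio i j) *
    shiftedFactorial (nome n) (MvPowerSeries.C c⁻¹ * coratio i j)

open scoped MvPowerSeries.WithPiTopology in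
/-- The expansion of `Γ(c x_j / x_i; p, q)
= (p q x_i / (c x_j); p, q)_∞ / (c x_j / x_i; p, q)_∞`, for `i < j`. -/
def formalGamma (q c : ℂ) (i j : Fin n) : Series n :=
  doubleShiftedFactorial (nome n) (MvPowerSeries.C q) (MvPowerSeries.C (q / c) * coratio i j) *
    (doubleShiftedFactorial (nome n) (MvPowerSeries.C q) (MvPowerSeries.C c * ratio i j))⁻¹

/-! ### The modified elliptic Ruijsenaars operators -/

/-- The `q`-shift `∏_{i ∈ I} T_{q, x_i}`, with `p` fixed: the exponent of `x_i` in `z ^ k` is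
`k_i - k_{i+1}`, with cyclic indices. -/
def qShift [NeZero n] (q : ℂ) (I : Finset (Fin n)) (f : Series n) : Series n :=
  fun k => (∏ i ∈ I, q ^ ((k i : ℤ) - (k (i + 1) : ℤ))) * MvPowerSeries.coeff k f

/-- The coefficient `B_I(x; p)`, the product of `θ(x_j / (t x_i); p) / θ(x_j / x_i; p)` over
`i < j` with `i ∈ I`, `j ∉ I`, and of `θ(t x_j / x_i; p) / θ(x_j / x_i; p)` over `i < j` with
`i ∉ I`, `j ∈ I`. -/
def coefficientB (t : ℂ) (I : Finset (Fin n)) : Series n :=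
  (∏ i ∈ I, ∏ j ∈ Iᶜ with i < j, formalTheta t⁻¹ i j * (formalTheta 1 i j)⁻¹) *
    ∏ i ∈ Iᶜ, ∏ j ∈ I with i < j, formalTheta t i j * (formalTheta 1 i j)⁻¹

/-- The operator of order `r`: the sum of `s ^ I B_I(x; p) T_{q, x} ^ I` over the `r`-element
sets `I`. -/
def modifiedOperator [NeZero n] (q t : ℂ) (s : Fin n → ℂ) (r : ℕ) (f : Series n) : Series n :=
  ∑ I ∈ Finset.powersetCard r Finset.univ,
    MvPowerSeries.C (∏ i ∈ I, s i) * coefficientB t I * qShift q I f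

/-- `f` is the normalized Ruijsenaars function `f(x; s; p | q, t)` and `ε r`, `1 ≤ r ≤ n`, are its
eigenvalues: `f` is a joint eigenfunction of the modified elliptic Ruijsenaars operators, with
eigenvalues that are power series in `p`, and the constant term of `f` with respect to `x` is `1`. -/
structure IsRuijsenaarsFunction [NeZero n] (q t : ℂ) (s : Fin n → ℂ) (f : Series n)
    (ε : ℕ → PowerSeries ℂ) : Prop where
  eigen : ∀ r, 1 ≤ r → r ≤ n → modifiedOperator q t s r f = ofNome n (ε r) * f
  normalized : ∀ m : ℕ,
    MvPowerSeries.coeff (Finsupp.equivFunOnFinite.symm fun _ : Fin n => m) f = if m = 0 then 1 else 0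

/-- The expansion of `∏_{i < j} Γ(t x_j / x_i; p, q) / Γ(q x_j / (t x_i); p, q)`. -/
def formalReflectionFactor (n : ℕ) (q t : ℂ) : Series n :=
  ∏ i : Fin n, ∏ j ∈ Finset.Ioi i, formalGamma q t i j * (formalGamma q (q / t) i j)⁻¹

/-! ### Values of convergent series -/

/-- The value `z_j = x_j / x_{j-1}` for `j ≠ 0`, and `z_0 = p x₀ / x_{n-1}` (cyclic indices). -/
def zCoord [NeZero n] (p : ℂ) (x : Fin n → ℂ) (j : Fin n) : ℂ :=
  (if j = 0 then p else 1) * x j / x (j - 1)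

/-- The value at the point `z` of the monomial `z ^ k` of `f`, with its coefficient. -/
def termAt (f : Series n) (z : Fin n → ℂ) (k : Fin n →₀ ℕ) : ℂ :=
  MvPowerSeries.coeff k f * ∏ i, z i ^ k i

/-- `f` converges absolutely in a neighbourhood of `z = 0`. -/
def IsConvergent (f : Series n) : Prop :=
  ∃ r : ℝ, 0 < r ∧ ∀ z : Fin n → ℂ, (∀ i, ‖z i‖ < r) → Summable fun k => ‖termAt f z k‖

/-- The product `∏_{i < j} Γ(t x_j / x_i; p, q) / Γ(q x_j / (t x_i); p, q)` of complex numbers. -/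
def reflectionFactor (p q t : ℂ) (x : Fin n → ℂ) : ℂ :=
  ∏ i : Fin n, ∏ j ∈ Finset.Ioi i,
    ellipticGamma p q (t * x j / x i) / ellipticGamma p q (q * x j / (t * x i))

end

end Ruijsenaars

namespace Ruijsenaars

noncomputable section

/-! ### The Banach algebra of absolutely convergent series -/

/-- The coefficient of `z ^ k`, times `ρ ^ |k|`. -/
def weighted {n : ℕ} (ρ : ℝ) (f : Series n) (k : Fin n →₀ ℕ) : ℂ :=
  MvPowerSeries.coeff k f * (ρ : ℂ) ^ k.degree

section Weighted

variable {n : ℕ} (ρ : ℝ)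

theorem weighted_zero (k : Fin n →₀ ℕ) : weighted ρ 0 k = 0 := by simp [weighted]

theorem weighted_add (f g : Series n) (k : Fin n →₀ ℕ) :
    weighted ρ (f + g) k = weighted ρ f k + weighted ρ g k := by simp [weighted, add_mul]

theorem weighted_neg (f : Series n) (k : Fin n →₀ ℕ) :
    weighted ρ (-f) k = -weighted ρ f k := by simp [weighted]

theorem weighted_mul (f g : Series n) (k : Fin n →₀ ℕ) :
    weighted ρ (f * g) k =
      ∑ kl ∈ Finset.HasAntidiagonal.antidiagonal k, weighted ρ f kl.1 * weighted ρ g kl.2 := by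
  classical
  simp only [weighted, MvPowerSeries.coeff_mul, Finset.sum_mul]
  refine Finset.sum_congr rfl fun x hx => ?_
  rw [← Finset.HasAntidiagonal.mem_antidiagonal.1 hx, map_add, pow_add]
  ring

theorem norm_weighted_mul_le (f g : Series n) (k : Fin n →₀ ℕ) :
    ‖weighted ρ (f * g) k‖ ≤
      ∑ kl ∈ Finset.HasAntidiagonal.antidiagonal k, ‖weighted ρ f kl.1‖ * ‖weighted ρ g kl.2‖ := by
  rw [weighted_mul]
  exact (norm_sum_le _ _).trans (Finset.sum_le_sum fun _ _ => norm_mul_le _ _)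

theorem summable_antidiagonal_weighted {f g : Series n}
    (hf : Summable fun k => ‖weighted ρ f k‖) (hg : Summable fun k => ‖weighted ρ g k‖) :
    Summable fun k =>
      ∑ kl ∈ Finset.HasAntidiagonal.antidiagonal k, ‖weighted ρ f kl.1‖ * ‖weighted ρ g kl.2‖ :=
  summable_sum_mul_antidiagonal_of_summable_mul (f := fun k => ‖weighted ρ f k‖)
    (g := fun k => ‖weighted ρ g k‖)
    (hf.mul_of_nonneg hg (fun _ => norm_nonneg _) fun _ => norm_nonneg _)

theorem hasSum_weighted_monomial (d : Fin n →₀ ℕ) (c : ℂ) :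
    HasSum (fun k => ‖weighted ρ (MvPowerSeries.monomial d c) k‖) (‖c‖ * |ρ| ^ d.degree) := by
  classical
  convert hasSum_single d ?_ using 1
  · simp [weighted]
  · intro k hk
    simp [weighted, MvPowerSeries.coeff_monomial, hk]

end Weighted

/-- The ring of series `f` with `∑ |f_k| ρ ^ |k| < ∞`. -/
def convergentSubring (n : ℕ) (ρ : ℝ) : Subring (Series n) where
  carrier := {f | Summable fun k => ‖weighted ρ f k‖}
  mul_mem' {f g} hf hg := (summable_antidiagonal_weighted ρ hf hg).of_nonneg_of_le
    (fun _ => norm_nonneg _) (norm_weighted_mul_le ρ f g)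
  one_mem' := (hasSum_weighted_monomial ρ 0 1).summable
  add_mem' {f g} hf hg := (hf.add hg).of_nonneg_of_le (fun _ => norm_nonneg _) fun k => by
    rw [weighted_add]
    exact norm_add_le _ _
  zero_mem' := by simp [weighted_zero]
  neg_mem' {f} hf := by simpa [weighted_neg] using hf

section Banach

variable {n : ℕ} {ρ : ℝ}

theorem mem_convergentSubring {f : Series n} :
    f ∈ convergentSubring n ρ ↔ Summable fun k => ‖weighted ρ f k‖ := Iff.rfl

theorem monomial_mem_convergentSubring (d : Fin n →₀ ℕ) (c : ℂ) :
    MvPowerSeries.monomial d c ∈ convergentSubring n ρ :=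
  (hasSum_weighted_monomial ρ d c).summable

/-- The ring `convergentSubring n ρ`, with the topology given by the weighted `ℓ¹` norm. -/
def ConvergentSeries (n : ℕ) (ρ : ℝ) : Type := convergentSubring n ρ

instance : CommRing (ConvergentSeries n ρ) :=
  inferInstanceAs (CommRing (convergentSubring n ρ))

/-- The inclusion into the ring of formal power series. -/
def ConvergentSeries.toSeries (n : ℕ) (ρ : ℝ) : ConvergentSeries n ρ →+* Series n :=
  (convergentSubring n ρ).subtype

theorem ConvergentSeries.toSeries_injective :
    Function.Injective (ConvergentSeries.toSeries n ρ) := Subtype.val_injective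

/-- An element of the subring. -/
def ConvergentSeries.mk (f : Series n) (hf : f ∈ convergentSubring n ρ) : ConvergentSeries n ρ :=
  ⟨f, hf⟩

theorem ConvergentSeries.toSeries_mk (f : Series n) (hf : f ∈ convergentSubring n ρ) :
    ConvergentSeries.toSeries n ρ (ConvergentSeries.mk f hf) = f := rfl

/-- The sequence of weighted coefficients. -/
def toLp (n : ℕ) (ρ : ℝ) : ConvergentSeries n ρ →+ lp (fun _ : Fin n →₀ ℕ => ℂ) 1 where
  toFun f := ⟨weighted ρ f.1, memℓp_gen (by simpa using mem_convergentSubring.1 f.2)⟩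
  map_zero' := by
    ext k
    exact weighted_zero ρ k
  map_add' f g := by
    ext k
    exact weighted_add ρ f.1 g.1 k

theorem toLp_apply (f : ConvergentSeries n ρ) (k : Fin n →₀ ℕ) :
    toLp n ρ f k = weighted ρ f.1 k := rfl

theorem coeff_eq_weighted (hρ : 0 < ρ) (f : Series n) (k : Fin n →₀ ℕ) :
    MvPowerSeries.coeff k f = weighted ρ f k / (ρ : ℂ) ^ k.degree := by
  have : (ρ : ℂ) ^ k.degree ≠ 0 := pow_ne_zero _ (by exact_mod_cast hρ.ne')
  rw [weighted, mul_div_cancel_right₀ _ this]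

variable [hρ : Fact (0 < ρ)]

theorem toLp_injective : Function.Injective (toLp n ρ) := by
  intro f g h
  refine ConvergentSeries.toSeries_injective (MvPowerSeries.ext fun k => ?_)
  change MvPowerSeries.coeff k f.1 = MvPowerSeries.coeff k g.1
  rw [coeff_eq_weighted hρ.out, coeff_eq_weighted hρ.out, ← toLp_apply, h, toLp_apply]

theorem toLp_surjective : Function.Surjective (toLp n ρ) := by
  intro g
  let f : Series n := fun k => g k / (ρ : ℂ) ^ k.degree
  have hf : weighted ρ f = g := by
    ext k
    have : (ρ : ℂ) ^ k.degree ≠ 0 := pow_ne_zero _ (by exact_mod_cast hρ.out.ne')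
    exact div_mul_cancel₀ _ this
  refine ⟨⟨f, ?_⟩, ?_⟩
  · rw [mem_convergentSubring, hf]
    simpa using (lp.memℓp g).summable (by simp)
  · ext k
    exact congrFun hf k

instance : NormedAddCommGroup (ConvergentSeries n ρ) :=
  NormedAddCommGroup.induced _ _ (toLp n ρ) toLp_injective

theorem norm_def (f : ConvergentSeries n ρ) : ‖f‖ = ∑' k, ‖weighted ρ f.1 k‖ := by
  change ‖toLp n ρ f‖ = _
  rw [lp.norm_eq_tsum_rpow (by simp)]
  simp [toLp_apply]

instance : NormedCommRing (ConvergentSeries n ρ) where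
  __ := (inferInstance : CommRing (ConvergentSeries n ρ))
  __ := (inferInstance : NormedAddCommGroup (ConvergentSeries n ρ))
  norm_mul_le f g := by
    rw [norm_def, norm_def, norm_def,
      f.2.tsum_mul_tsum_eq_tsum_sum_antidiagonal g.2
        (f.2.mul_of_nonneg g.2 (fun _ => norm_nonneg _) fun _ => norm_nonneg _)]
    exact (f * g).2.tsum_le_tsum (norm_weighted_mul_le ρ f.1 g.1)
      (summable_antidiagonal_weighted ρ f.2 g.2)

theorem isometry_toLp : Isometry (toLp n ρ) :=
  AddMonoidHomClass.isometry_of_norm _ fun _ => rfl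

instance : CompleteSpace (ConvergentSeries n ρ) :=
  (isometry_toLp.isUniformInducing.completeSpace_congr toLp_surjective).2 inferInstance

theorem norm_monomial (d : Fin n →₀ ℕ) (c : ℂ) :
    ‖ConvergentSeries.mk (ρ := ρ) (MvPowerSeries.monomial d c)
      (monomial_mem_convergentSubring d c)‖ = ‖c‖ * ρ ^ d.degree := by
  rw [norm_def]
  exact (hasSum_weighted_monomial ρ d c).tsum_eq.trans (by rw [abs_of_pos hρ.out])

instance : NormOneClass (ConvergentSeries n ρ) :=
  ⟨(norm_def _).trans ((hasSum_weighted_monomial ρ (0 : Fin n →₀ ℕ) 1).tsum_eq.trans (by simp))⟩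

open scoped MvPowerSeries.WithPiTopology in
theorem continuous_toSeries : Continuous (ConvergentSeries.toSeries n ρ) := by
  refine continuous_pi fun k => ?_
  have h : Continuous fun f : ConvergentSeries n ρ => toLp n ρ f k / (ρ : ℂ) ^ k.degree :=
    (((continuous_apply k).comp lp.uniformContinuous_coe.continuous).comp
      isometry_toLp.continuous).div_const ((ρ : ℂ) ^ k.degree)
  refine h.congr fun f => ?_
  rw [toLp_apply, ← coeff_eq_weighted hρ.out]
  rfl

end Banach

/-! ### Values -/

section Values

variable {n : ℕ} {ρ : ℝ} {z : Fin n → ℂ}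

/-- The value of a series at the point `z`. -/
def value (z : Fin n → ℂ) (f : Series n) : ℂ := ∑' k, termAt f z k

theorem norm_termAt_le (hz : ∀ i, ‖z i‖ ≤ ρ) (f : Series n) (k : Fin n →₀ ℕ) :
    ‖termAt f z k‖ ≤ ‖weighted ρ f k‖ := by
  rw [termAt, weighted, norm_mul, norm_mul]
  gcongr
  rw [norm_prod, Finsupp.degree_eq_sum, norm_pow, ← Finset.prod_pow_eq_pow_sum]
  refine Finset.prod_le_prod (fun _ _ => norm_nonneg _) fun i _ => ?_
  rw [norm_pow]
  gcongr
  simpa using (hz i).trans (le_abs_self ρ)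

theorem summable_norm_termAt (hz : ∀ i, ‖z i‖ ≤ ρ) {f : Series n}
    (hf : f ∈ convergentSubring n ρ) : Summable fun k => ‖termAt f z k‖ :=
  Summable.of_nonneg_of_le (fun _ => norm_nonneg _) (norm_termAt_le hz f) hf

theorem termAt_mul (f g : Series n) (k : Fin n →₀ ℕ) :
    termAt (f * g) z k =
      ∑ kl ∈ Finset.HasAntidiagonal.antidiagonal k, termAt f z kl.1 * termAt g z kl.2 := by
  classical
  simp only [termAt, MvPowerSeries.coeff_mul, Finset.sum_mul]
  refine Finset.sum_congr rfl fun x hx => ?_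
  rw [← Finset.HasAntidiagonal.mem_antidiagonal.1 hx]
  simp only [Finsupp.add_apply, pow_add, Finset.prod_mul_distrib]
  ring

theorem value_monomial (d : Fin n →₀ ℕ) (c : ℂ) :
    value z (MvPowerSeries.monomial d c) = c * ∏ i, z i ^ d i := by
  classical
  rw [value, tsum_eq_single d]
  · simp [termAt]
  · intro k hk
    simp [termAt, MvPowerSeries.coeff_monomial, hk]

theorem value_mul (hz : ∀ i, ‖z i‖ ≤ ρ) {f g : Series n} (hf : f ∈ convergentSubring n ρ)
    (hg : g ∈ convergentSubring n ρ) : value z (f * g) = value z f * value z g := by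
  have hf := summable_norm_termAt hz hf
  have hg := summable_norm_termAt hz hg
  have h := Summable.tsum_mul_tsum_eq_tsum_sum_antidiagonal (f := termAt f z) (g := termAt g z)
    hf.of_norm hg.of_norm (summable_mul_of_summable_norm hf hg)
  rw [value, value, value, h]
  exact tsum_congr fun k => termAt_mul f g k

theorem value_zero : value z 0 = 0 := by simp [value, termAt]

theorem value_add (hz : ∀ i, ‖z i‖ ≤ ρ) {f g : Series n} (hf : f ∈ convergentSubring n ρ)
    (hg : g ∈ convergentSubring n ρ) : value z (f + g) = value z f + value z g := by
  rw [value, value, value, ← (summable_norm_termAt hz hf).of_norm.tsum_add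
    (summable_norm_termAt hz hg).of_norm]
  exact tsum_congr fun k => by simp [termAt, add_mul]

/-- Evaluation at a point of the polydisc of radius `ρ`. -/
def evalHom (hz : ∀ i, ‖z i‖ ≤ ρ) : ConvergentSeries n ρ →+* ℂ where
  toFun f := value z f.1
  map_one' := by
    have := value_monomial (z := z) 0 1
    rwa [MvPowerSeries.monomial_zero_one, one_mul, Finset.prod_eq_one fun i _ => by simp] at this
  map_mul' f g := value_mul hz f.2 g.2
  map_zero' := value_zero
  map_add' f g := value_add hz f.2 g.2

theorem evalHom_apply (hz : ∀ i, ‖z i‖ ≤ ρ) (f : ConvergentSeries n ρ) :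
    evalHom hz f = value z (ConvergentSeries.toSeries n ρ f) := rfl

theorem continuous_evalHom [Fact (0 < ρ)] (hz : ∀ i, ‖z i‖ ≤ ρ) : Continuous (evalHom hz) := by
  refine AddMonoidHomClass.continuous_of_bound (evalHom hz) 1 fun f => ?_
  rw [one_mul, norm_def]
  exact (norm_tsum_le_tsum_norm (summable_norm_termAt hz f.2)).trans
    ((summable_norm_termAt hz f.2).tsum_le_tsum (norm_termAt_le hz f.1) f.2)

end Values

/-! ### Shifted factorials in Banach algebras -/

section Products

variable {A : Type*} [NormedCommRing A] [NormOneClass A] [CompleteSpace A] {p q : A}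

theorem multipliable_shiftedFactorial (hp : ‖p‖ < 1) (z : A) :
    Multipliable fun i : ℕ => 1 - p ^ i * z := by
  simp_rw [sub_eq_add_neg]
  refine multipliable_one_add_of_summable (Summable.of_nonneg_of_le (fun _ => norm_nonneg _)
    (fun i => ?_) ((summable_geometric_of_lt_one (norm_nonneg p) hp).mul_right ‖z‖))
  rw [norm_neg]
  exact (norm_mul_le _ _).trans (by gcongr; exact norm_pow_le p i)

theorem multipliable_doubleShiftedFactorial (hp : ‖p‖ < 1) (hq : ‖q‖ < 1) (z : A) :
    Multipliable fun k : ℕ × ℕ => 1 - p ^ k.1 * q ^ k.2 * z := by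
  simp_rw [sub_eq_add_neg]
  have h := (summable_geometric_of_lt_one (norm_nonneg p) hp).mul_of_nonneg
    (summable_geometric_of_lt_one (norm_nonneg q) hq) (fun _ => by positivity)
    (fun _ => by positivity)
  refine multipliable_one_add_of_summable (Summable.of_nonneg_of_le (fun _ => norm_nonneg _)
    (fun k => ?_) (h.mul_right ‖z‖))
  rw [norm_neg]
  refine (norm_mul_le _ _).trans ?_
  gcongr
  refine (norm_mul_le _ _).trans ?_
  gcongr <;> exact norm_pow_le _ _

theorem doubleShiftedFactorial_eq_mul (hp : ‖p‖ < 1) (hq : ‖q‖ < 1) (z : A) :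
    doubleShiftedFactorial p q z = shiftedFactorial p z * doubleShiftedFactorial p q (q * z) := by
  have h₁ : Function.Injective fun i : ℕ => (i, 0) := fun i j h => by simpa using h
  have h₂ : Function.Injective fun k : ℕ × ℕ => (k.1, k.2 + 1) := fun i j h => by
    simpa [Prod.ext_iff] using h
  have hc : IsCompl (Set.range fun i : ℕ => (i, 0))
      (Set.range fun k : ℕ × ℕ => (k.1, k.2 + 1)) := by
    refine IsCompl.of_eq (Set.eq_empty_of_forall_notMem ?_) (Set.eq_univ_of_forall ?_)
    · rintro _ ⟨⟨i, rfl⟩, ⟨k, hk⟩⟩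
      simp at hk
    · rintro ⟨i, _ | j⟩
      · exact Or.inl ⟨i, rfl⟩
      · exact Or.inr ⟨(i, j), rfl⟩
  have e₁ := (multipliable_shiftedFactorial hp z).hasProd
  have e₂ := (multipliable_doubleShiftedFactorial hp hq (q * z)).hasProd
  let F : ℕ × ℕ → A := fun k => 1 - p ^ k.1 * q ^ k.2 * z
  have f₁ : (fun i : ℕ => 1 - p ^ i * z) = F ∘ fun i : ℕ => (i, 0) := by
    ext i
    simp [F]
  have f₂ : (fun k : ℕ × ℕ => 1 - p ^ k.1 * q ^ k.2 * (q * z)) =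
      F ∘ fun k : ℕ × ℕ => (k.1, k.2 + 1) := by
    ext k
    simp only [F, Function.comp_apply, pow_succ]
    ring
  rw [f₁] at e₁
  rw [f₂] at e₂
  have := (HasProd.mul_isCompl hc (h₁.hasProd_range_iff.2 e₁) (h₂.hasProd_range_iff.2 e₂)).tprod_eq
  rwa [← f₁, ← f₂] at this

end Products

section Map

variable {A B : Type*} [CommRing A] [TopologicalSpace A] [CommRing B] [TopologicalSpace B]
  [T2Space B]

theorem map_shiftedFactorial (φ : A →+* B) (hφ : Continuous φ) {p z : A}
    (h : Multipliable fun i : ℕ => 1 - p ^ i * z) :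
    φ (shiftedFactorial p z) = shiftedFactorial (φ p) (φ z) := by
  rw [shiftedFactorial, h.map_tprod φ hφ]
  simp [shiftedFactorial]

theorem map_doubleShiftedFactorial (φ : A →+* B) (hφ : Continuous φ) {p q z : A}
    (h : Multipliable fun k : ℕ × ℕ => 1 - p ^ k.1 * q ^ k.2 * z) :
    φ (doubleShiftedFactorial p q z) = doubleShiftedFactorial (φ p) (φ q) (φ z) := by
  rw [doubleShiftedFactorial, h.map_tprod φ hφ]
  simp [doubleShiftedFactorial]

end Map

/-! ### Shifted factorials of power series -/

section Series

variable {n : ℕ}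

theorem C_mem_convergentSubring (ρ : ℝ) (c : ℂ) :
    (MvPowerSeries.C c : Series n) ∈ convergentSubring n ρ :=
  monomial_mem_convergentSubring 0 c

theorem X_mem_convergentSubring (ρ : ℝ) (m : Fin n) :
    (MvPowerSeries.X m : Series n) ∈ convergentSubring n ρ :=
  monomial_mem_convergentSubring _ 1

theorem prod_X_mem_convergentSubring (ρ : ℝ) (u : Finset (Fin n)) :
    (∏ m ∈ u, MvPowerSeries.X m : Series n) ∈ convergentSubring n ρ :=
  Subring.prod_mem _ fun m _ => X_mem_convergentSubring ρ m

theorem C_mul_prod_X_mem_convergentSubring (ρ : ℝ) (c : ℂ) (u : Finset (Fin n)) :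
    MvPowerSeries.C c * (∏ m ∈ u, MvPowerSeries.X m : Series n) ∈ convergentSubring n ρ :=
  Subring.mul_mem _ (C_mem_convergentSubring ρ c) (prod_X_mem_convergentSubring ρ u)

theorem value_C (z : Fin n → ℂ) (c : ℂ) : value z (MvPowerSeries.C c) = c := by
  have := value_monomial (z := z) 0 c
  rwa [Finset.prod_eq_one fun i _ => by simp, mul_one] at this

theorem value_X (z : Fin n → ℂ) (m : Fin n) : value z (MvPowerSeries.X m) = z m := by
  classical
  have := value_monomial (z := z) (Finsupp.single m 1) 1
  rwa [one_mul, Finset.prod_eq_single m (fun i _ hi => by simp [hi.symm]) (by simp),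
    Finsupp.single_eq_same, pow_one] at this

theorem value_prod {ι : Type*} {ρ : ℝ} {z : Fin n → ℂ} (hz : ∀ i, ‖z i‖ ≤ ρ) (u : Finset ι)
    (f : ι → Series n) (hf : ∀ i ∈ u, f i ∈ convergentSubring n ρ) :
    value z (∏ i ∈ u, f i) = ∏ i ∈ u, value z (f i) := by
  classical
  induction u using Finset.induction with
  | empty => simpa using value_C z 1
  | insert a u ha ih =>
    rw [Finset.prod_insert ha, Finset.prod_insert ha, value_mul hz
      (hf a (Finset.mem_insert_self a u))
      (Subring.prod_mem _ fun i hi => hf i (Finset.mem_insert_of_mem hi)),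
      ih fun i hi => hf i (Finset.mem_insert_of_mem hi)]

theorem value_C_mul_prod_X {ρ : ℝ} {z : Fin n → ℂ} (hz : ∀ i, ‖z i‖ ≤ ρ) (c : ℂ)
    (u : Finset (Fin n)) :
    value z (MvPowerSeries.C c * ∏ m ∈ u, MvPowerSeries.X m) = c * ∏ m ∈ u, z m := by
  rw [value_mul hz (C_mem_convergentSubring ρ c) (prod_X_mem_convergentSubring ρ u), value_C,
    value_prod hz u _ fun m _ => X_mem_convergentSubring ρ m]
  simp only [value_X]

theorem nome_mem_convergentSubring (ρ : ℝ) : nome n ∈ convergentSubring n ρ :=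
  prod_X_mem_convergentSubring ρ _

theorem value_nome {ρ : ℝ} {z : Fin n → ℂ} (hz : ∀ i, ‖z i‖ ≤ ρ) :
    value z (nome n) = ∏ m, z m := by
  rw [nome, value_prod hz _ _ fun m _ => X_mem_convergentSubring ρ m]
  simp only [value_X]

theorem norm_mk_nome_lt_one [NeZero n] {ρ : ℝ} [hρ : Fact (0 < ρ)] (h : ρ < 1) :
    ‖ConvergentSeries.mk (nome n) (nome_mem_convergentSubring ρ)‖ < 1 := by
  have hX : ∀ m : Fin n, ‖ConvergentSeries.mk (ρ := ρ) (MvPowerSeries.X m)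
      (X_mem_convergentSubring ρ m)‖ = ρ := fun m =>
    (norm_monomial (Finsupp.single m 1) 1).trans (by simp)
  have : ConvergentSeries.mk (nome n) (nome_mem_convergentSubring ρ) =
      ∏ m : Fin n, ConvergentSeries.mk (MvPowerSeries.X m) (X_mem_convergentSubring ρ m) := by
    refine ConvergentSeries.toSeries_injective ?_
    rw [map_prod]
    rfl
  rw [this]
  refine (Finset.norm_prod_le _ _).trans_lt ?_
  simp only [hX, Finset.prod_const, Finset.card_univ, Fintype.card_fin]
  exact pow_lt_one₀ hρ.out.le h (NeZero.ne n)

theorem norm_mk_C {ρ : ℝ} [Fact (0 < ρ)] (q : ℂ) :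
    ‖ConvergentSeries.mk (n := n) (MvPowerSeries.C q) (C_mem_convergentSubring ρ q)‖ = ‖q‖ :=
  (norm_monomial 0 q).trans (by simp)

variable [NeZero n] {q : ℂ} {ρ : ℝ} {w : Series n}

open scoped MvPowerSeries.WithPiTopology in
theorem multipliable_shiftedFactorial_series (hρ : 0 < ρ) (hρ1 : ρ < 1)
    (hw : w ∈ convergentSubring n ρ) : Multipliable fun i : ℕ => 1 - nome n ^ i * w := by
  have := Fact.mk hρ
  simpa [Function.comp_def, ConvergentSeries.toSeries_mk] using
    (multipliable_shiftedFactorial (norm_mk_nome_lt_one hρ1) (ConvergentSeries.mk w hw)).map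
      (ConvergentSeries.toSeries n ρ) continuous_toSeries

open scoped MvPowerSeries.WithPiTopology in
theorem multipliable_doubleShiftedFactorial_series (hq : ‖q‖ < 1) (hρ : 0 < ρ) (hρ1 : ρ < 1)
    (hw : w ∈ convergentSubring n ρ) :
    Multipliable fun k : ℕ × ℕ => 1 - nome n ^ k.1 * MvPowerSeries.C q ^ k.2 * w := by
  have := Fact.mk hρ
  simpa [Function.comp_def, ConvergentSeries.toSeries_mk] using
    (multipliable_doubleShiftedFactorial (norm_mk_nome_lt_one hρ1)
      ((norm_mk_C q).trans_lt hq) (ConvergentSeries.mk w hw)).map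
      (ConvergentSeries.toSeries n ρ) continuous_toSeries

open scoped MvPowerSeries.WithPiTopology in
theorem toSeries_shiftedFactorial [Fact (0 < ρ)] (hρ1 : ρ < 1)
    (hw : w ∈ convergentSubring n ρ) :
    ConvergentSeries.toSeries n ρ (shiftedFactorial
      (ConvergentSeries.mk (nome n) (nome_mem_convergentSubring ρ)) (ConvergentSeries.mk w hw)) =
      shiftedFactorial (nome n) w :=
  map_shiftedFactorial _ continuous_toSeries
    (multipliable_shiftedFactorial (norm_mk_nome_lt_one hρ1) _)

open scoped MvPowerSeries.WithPiTopology in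
theorem toSeries_doubleShiftedFactorial (hq : ‖q‖ < 1) [Fact (0 < ρ)] (hρ1 : ρ < 1)
    (hw : w ∈ convergentSubring n ρ) :
    ConvergentSeries.toSeries n ρ (doubleShiftedFactorial
      (ConvergentSeries.mk (nome n) (nome_mem_convergentSubring ρ))
      (ConvergentSeries.mk (MvPowerSeries.C q) (C_mem_convergentSubring ρ q))
      (ConvergentSeries.mk w hw)) =
      doubleShiftedFactorial (nome n) (MvPowerSeries.C q) w :=
  map_doubleShiftedFactorial _ continuous_toSeries
    (multipliable_doubleShiftedFactorial (norm_mk_nome_lt_one hρ1) ((norm_mk_C q).trans_lt hq) _)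

open scoped MvPowerSeries.WithPiTopology in
theorem doubleShiftedFactorial_series_eq_mul (hq : ‖q‖ < 1) (hρ : 0 < ρ) (hρ1 : ρ < 1)
    (hw : w ∈ convergentSubring n ρ) :
    doubleShiftedFactorial (nome n) (MvPowerSeries.C q) w = shiftedFactorial (nome n) w *
      doubleShiftedFactorial (nome n) (MvPowerSeries.C q) (MvPowerSeries.C q * w) := by
  have := Fact.mk hρ
  rw [← toSeries_doubleShiftedFactorial hq hρ1 hw, ← toSeries_shiftedFactorial hρ1 hw,
    ← toSeries_doubleShiftedFactorial hq hρ1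
      (Subring.mul_mem _ (C_mem_convergentSubring ρ q) hw), ← map_mul,
    doubleShiftedFactorial_eq_mul (norm_mk_nome_lt_one hρ1) ((norm_mk_C q).trans_lt hq)]
  rfl

open scoped MvPowerSeries.WithPiTopology in
theorem doubleShiftedFactorial_mem_convergentSubring (hq : ‖q‖ < 1) (hρ : 0 < ρ) (hρ1 : ρ < 1)
    (hw : w ∈ convergentSubring n ρ) :
    doubleShiftedFactorial (nome n) (MvPowerSeries.C q) w ∈ convergentSubring n ρ := by
  have := Fact.mk hρ
  rw [← toSeries_doubleShiftedFactorial hq hρ1 hw]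
  exact Subtype.property _

open scoped MvPowerSeries.WithPiTopology in
theorem value_doubleShiftedFactorial (hq : ‖q‖ < 1) (hρ : 0 < ρ) (hρ1 : ρ < 1)
    (hw : w ∈ convergentSubring n ρ) {z : Fin n → ℂ} (hz : ∀ i, ‖z i‖ ≤ ρ) :
    value z (doubleShiftedFactorial (nome n) (MvPowerSeries.C q) w) =
      doubleShiftedFactorial (∏ m, z m) q (value z w) := by
  have := Fact.mk hρ
  rw [← toSeries_doubleShiftedFactorial hq hρ1 hw, ← evalHom_apply hz,
    map_doubleShiftedFactorial (evalHom hz) (continuous_evalHom hz)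
      (multipliable_doubleShiftedFactorial (norm_mk_nome_lt_one hρ1) ((norm_mk_C q).trans_lt hq) _)]
  simp only [evalHom_apply, ConvergentSeries.toSeries_mk, value_nome hz, value_C]

open scoped MvPowerSeries.WithPiTopology in
theorem constantCoeff_shiftedFactorial (hρ : 0 < ρ) (hρ1 : ρ < 1)
    (hw : w ∈ convergentSubring n ρ) (h0 : MvPowerSeries.constantCoeff w = 0) :
    MvPowerSeries.constantCoeff (shiftedFactorial (nome n) w) = 1 := by
  rw [map_shiftedFactorial MvPowerSeries.constantCoeff
    (MvPowerSeries.WithPiTopology.continuous_constantCoeff ℂ)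
    (multipliable_shiftedFactorial_series hρ hρ1 hw), h0]
  simp [shiftedFactorial]

open scoped MvPowerSeries.WithPiTopology in
theorem constantCoeff_doubleShiftedFactorial (hq : ‖q‖ < 1) (hρ : 0 < ρ) (hρ1 : ρ < 1)
    (hw : w ∈ convergentSubring n ρ) (h0 : MvPowerSeries.constantCoeff w = 0) :
    MvPowerSeries.constantCoeff (doubleShiftedFactorial (nome n) (MvPowerSeries.C q) w) = 1 := by
  rw [map_doubleShiftedFactorial MvPowerSeries.constantCoeff
    (MvPowerSeries.WithPiTopology.continuous_constantCoeff ℂ)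
    (multipliable_doubleShiftedFactorial_series hq hρ hρ1 hw), h0]
  simp [doubleShiftedFactorial]

end Series

/-! ### The `q`-shift -/

section Shift

variable {n : ℕ}

theorem constantCoeff_ratio {i j : Fin n} (hij : i < j) :
    MvPowerSeries.constantCoeff (ratio i j) = 0 := by
  rw [ratio, map_prod]
  exact Finset.prod_eq_zero (Finset.right_mem_Ioc.2 hij) (MvPowerSeries.constantCoeff_X j)

theorem constantCoeff_coratio [NeZero n] (i j : Fin n) :
    MvPowerSeries.constantCoeff (coratio i j) = 0 := by
  rw [coratio, map_prod]
  exact Finset.prod_eq_zero (i := 0) (by simp) (MvPowerSeries.constantCoeff_X 0)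

theorem C_mul_ratio_mem (ρ : ℝ) (c : ℂ) (i j : Fin n) :
    MvPowerSeries.C c * ratio i j ∈ convergentSubring n ρ :=
  C_mul_prod_X_mem_convergentSubring ρ c _

theorem C_mul_coratio_mem (ρ : ℝ) (c : ℂ) (i j : Fin n) :
    MvPowerSeries.C c * coratio i j ∈ convergentSubring n ρ :=
  C_mul_prod_X_mem_convergentSubring ρ c _

/-- The exponent of `q` in the shift of `z_m` by `∏_{i ∈ I} T_{q, x_i}`. -/
def shiftExponent [NeZero n] (I : Finset (Fin n)) (m : Fin n) : ℤ :=
  (if m ∈ I then 1 else 0) - if m - 1 ∈ I then 1 else 0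

/-- The `q`-shift as a ring homomorphism. -/
def qShiftHom [NeZero n] (q : ℂ) (I : Finset (Fin n)) : Series n →+* Series n :=
  MvPowerSeries.rescale fun m => q ^ shiftExponent I m

variable [NeZero n] {q : ℂ} (I : Finset (Fin n))

theorem zpow_sum_eq_prod (hq : q ≠ 0) {ι : Type*} (u : Finset ι) (g : ι → ℤ) :
    q ^ ∑ m ∈ u, g m = ∏ m ∈ u, q ^ g m := by
  classical
  induction u using Finset.induction with
  | empty => simp
  | insert a u ha ih => rw [Finset.prod_insert ha, Finset.sum_insert ha, zpow_add₀ hq, ih]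

theorem prod_zpow_shiftExponent (hq : q ≠ 0) (k : Fin n → ℕ) :
    ∏ m, (q ^ shiftExponent I m) ^ k m = ∏ i ∈ I, q ^ ((k i : ℤ) - (k (i + 1) : ℤ)) := by
  simp only [← zpow_natCast, ← zpow_mul]
  rw [← zpow_sum_eq_prod hq, ← zpow_sum_eq_prod hq, Finset.sum_sub_distrib]
  have h := Equiv.sum_comp (Equiv.addRight (1 : Fin n)) fun m =>
    (if m - 1 ∈ I then (1 : ℤ) else 0) * (k m : ℤ)
  simp only [Equiv.coe_addRight, add_sub_cancel_right] at h
  simp only [shiftExponent, sub_mul, Finset.sum_sub_distrib]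
  rw [← h]
  simp

theorem qShift_eq (hq : q ≠ 0) (f : Series n) : qShift q I f = qShiftHom q I f := by
  ext k
  rw [qShiftHom, MvPowerSeries.coeff_rescale, Finsupp.prod_fintype _ _ fun _ => pow_zero _,
    prod_zpow_shiftExponent I hq]
  rfl

theorem sum_shiftExponent : ∑ m, shiftExponent I m = 0 := by
  simp only [shiftExponent, Finset.sum_sub_distrib]
  rw [sub_eq_zero]
  exact ((Equiv.subRight (1 : Fin n)).sum_comp fun m => if m ∈ I then (1 : ℤ) else 0).symm

@[to_additive]
theorem prod_Ioc_eq_of_step {n : ℕ} {M : Type*} [CommMonoid M] {a b : Fin n → M}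
    {pred : Fin n → Fin n} {i j : Fin n} (hij : i ≤ j) (h₀ : b i = 1)
    (hpred : ∀ m, i < m → (pred m : ℕ) + 1 = m) (h : ∀ m, i < m → a m * b (pred m) = b m) :
    ∏ m ∈ Finset.Ioc i j, a m = b j := by
  obtain ⟨d, hd⟩ := Nat.exists_eq_add_of_le (Fin.le_def.1 hij)
  induction d generalizing j with
  | zero =>
    obtain rfl : j = i := Fin.ext (by simpa using hd)
    simp [h₀]
  | succ d ih =>
    have hlt : i < j := by rw [Fin.lt_def]; omega
    have hv := hpred j hlt
    have hle : i ≤ pred j := by rw [Fin.le_def]; omega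
    have hI : Finset.Ioc i j = insert j (Finset.Ioc i (pred j)) := by
      ext m
      simp only [Finset.mem_insert, Finset.mem_Ioc, Fin.lt_def, Fin.le_def, Fin.ext_iff]
      omega
    have hj : j ∉ Finset.Ioc i (pred j) := fun hm => by
      have := Fin.le_def.1 (Finset.mem_Ioc.1 hm).2
      omega
    rw [hI, Finset.prod_insert hj, ih hle (by omega), h j hlt]

theorem val_sub_one_add_one {i m : Fin n} (h : i < m) : ((m - 1 : Fin n) : ℕ) + 1 = m := by
  have h0 : m ≠ 0 := (lt_of_le_of_lt (Fin.zero_le i) h).ne'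
  have h1 : (m : ℕ) ≠ 0 := fun h => h0 (Fin.ext (by simpa using h))
  rw [Fin.val_sub_one_of_ne_zero h0]
  omega

theorem sum_Ioc_shiftExponent {i j : Fin n} (hij : i ≤ j) :
    ∑ m ∈ Finset.Ioc i j, shiftExponent I m =
      (if j ∈ I then 1 else 0) - if i ∈ I then 1 else 0 :=
  sum_Ioc_eq_of_step (b := fun j => (if j ∈ I then 1 else 0) - if i ∈ I then 1 else 0) hij
    (sub_self _) (fun _ => val_sub_one_add_one) fun _ _ => sub_add_sub_cancel _ _ _

theorem qShiftHom_C (c : ℂ) : qShiftHom q I (MvPowerSeries.C c) = MvPowerSeries.C c := by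
  classical
  ext k
  rw [qShiftHom, MvPowerSeries.coeff_rescale, MvPowerSeries.coeff_C]
  split_ifs with h <;> simp [h]

theorem qShiftHom_X (m : Fin n) : qShiftHom q I (MvPowerSeries.X m) =
    MvPowerSeries.C (q ^ shiftExponent I m) * MvPowerSeries.X m := by
  classical
  ext k
  rw [qShiftHom, MvPowerSeries.coeff_rescale, MvPowerSeries.coeff_C_mul, MvPowerSeries.coeff_X]
  split_ifs with h <;> simp [h]

theorem qShiftHom_prod_X (hq : q ≠ 0) (u : Finset (Fin n)) :
    qShiftHom q I (∏ m ∈ u, MvPowerSeries.X m) =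
      MvPowerSeries.C (q ^ ∑ m ∈ u, shiftExponent I m) * ∏ m ∈ u, MvPowerSeries.X m := by
  rw [map_prod, zpow_sum_eq_prod hq, map_prod, ← Finset.prod_mul_distrib]
  exact Finset.prod_congr rfl fun m _ => qShiftHom_X I m

theorem qShiftHom_nome (hq : q ≠ 0) : qShiftHom q I (nome n) = nome n := by
  rw [nome, qShiftHom_prod_X I hq, sum_shiftExponent]
  simp

/-- The exponent of `q` in the shift of `x_j / x_i`. -/
def ratioExponent (I : Finset (Fin n)) (i j : Fin n) : ℤ :=
  (if j ∈ I then 1 else 0) - if i ∈ I then 1 else 0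

theorem qShiftHom_ratio (hq : q ≠ 0) {i j : Fin n} (hij : i < j) :
    qShiftHom q I (ratio i j) = MvPowerSeries.C (q ^ ratioExponent I i j) * ratio i j := by
  rw [ratio, qShiftHom_prod_X I hq, sum_Ioc_shiftExponent I hij.le, ratioExponent]

theorem qShiftHom_coratio (hq : q ≠ 0) {i j : Fin n} (hij : i < j) :
    qShiftHom q I (coratio i j) =
      MvPowerSeries.C (q ^ ratioExponent I i j)⁻¹ * coratio i j := by
  have h := sum_shiftExponent I
  rw [← Finset.sum_add_sum_compl (Finset.Ioc i j), sum_Ioc_shiftExponent I hij.le] at h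
  rw [coratio, qShiftHom_prod_X I hq, ← zpow_neg, eq_neg_of_add_eq_zero_right h, ratioExponent]

theorem constantCoeff_qShiftHom (f : Series n) :
    MvPowerSeries.constantCoeff (qShiftHom q I f) = MvPowerSeries.constantCoeff f := by
  rw [← MvPowerSeries.coeff_zero_eq_constantCoeff_apply, qShiftHom, MvPowerSeries.coeff_rescale]
  simp

theorem qShiftHom_inv {f : Series n} (hf : MvPowerSeries.constantCoeff f ≠ 0) :
    qShiftHom q I f⁻¹ = (qShiftHom q I f)⁻¹ := by
  rw [MvPowerSeries.eq_inv_iff_mul_eq_one (by rwa [constantCoeff_qShiftHom]), ← map_mul,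
    MvPowerSeries.inv_mul_cancel _ hf, map_one]

open scoped MvPowerSeries.WithPiTopology in
theorem continuous_qShiftHom : Continuous (qShiftHom q I) := by
  refine continuous_pi fun k => ?_
  have : Continuous fun f : Series n =>
      (k.prod fun m e => (q ^ shiftExponent I m) ^ e) * MvPowerSeries.coeff k f :=
    continuous_const.mul (MvPowerSeries.WithPiTopology.continuous_coeff ℂ k)
  exact this.congr fun f => (MvPowerSeries.coeff_rescale f _ k).symm

open scoped MvPowerSeries.WithPiTopology in
theorem qShiftHom_doubleShiftedFactorial (hq0 : q ≠ 0) (hq1 : ‖q‖ < 1) {ρ : ℝ} (hρ : 0 < ρ)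
    (hρ1 : ρ < 1) {w : Series n} (hw : w ∈ convergentSubring n ρ) :
    qShiftHom q I (doubleShiftedFactorial (nome n) (MvPowerSeries.C q) w) =
      doubleShiftedFactorial (nome n) (MvPowerSeries.C q) (qShiftHom q I w) := by
  rw [map_doubleShiftedFactorial _ (continuous_qShiftHom I)
    (multipliable_doubleShiftedFactorial_series hq1 hρ hρ1 hw), qShiftHom_nome I hq0, qShiftHom_C]

end Shift

/-! ### Theta and gamma factors -/

section Factors

variable {n : ℕ} [NeZero n] {q : ℂ}

open scoped MvPowerSeries.WithPiTopology in
theorem constantCoeff_formalTheta (c : ℂ) {i j : Fin n} (hij : i < j) :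
    MvPowerSeries.constantCoeff (formalTheta c i j) = 1 := by
  rw [formalTheta, map_mul,
    constantCoeff_shiftedFactorial (ρ := 1 / 2) (by norm_num) (by norm_num)
      (C_mul_ratio_mem _ _ _ _) (by rw [map_mul, constantCoeff_ratio hij, mul_zero]),
    constantCoeff_shiftedFactorial (ρ := 1 / 2) (by norm_num) (by norm_num)
      (C_mul_coratio_mem _ _ _ _) (by rw [map_mul, constantCoeff_coratio, mul_zero]),
    mul_one]

open scoped MvPowerSeries.WithPiTopology in
/-- The denominator `(c x_j / x_i; p, q)_∞` of the gamma factor. -/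
def gammaDenominator (q c : ℂ) (i j : Fin n) : Series n :=
  doubleShiftedFactorial (nome n) (MvPowerSeries.C q) (MvPowerSeries.C c * ratio i j)

open scoped MvPowerSeries.WithPiTopology in
/-- The numerator `(c p x_i / x_j; p, q)_∞` of the gamma factor. -/
def gammaNumerator (q c : ℂ) (i j : Fin n) : Series n :=
  doubleShiftedFactorial (nome n) (MvPowerSeries.C q) (MvPowerSeries.C c * coratio i j)

theorem formalGamma_eq {n : ℕ} (q c : ℂ) (i j : Fin n) :
    formalGamma q c i j = gammaNumerator q (q / c) i j * (gammaDenominator q c i j)⁻¹ := rfl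

theorem constantCoeff_gammaDenominator (hq1 : ‖q‖ < 1) (c : ℂ) {i j : Fin n} (hij : i < j) :
    MvPowerSeries.constantCoeff (gammaDenominator q c i j) = 1 :=
  constantCoeff_doubleShiftedFactorial (ρ := 1 / 2) hq1 (by norm_num) (by norm_num)
    (C_mul_ratio_mem _ _ _ _) (by rw [map_mul, constantCoeff_ratio hij, mul_zero])

theorem constantCoeff_gammaNumerator (hq1 : ‖q‖ < 1) (c : ℂ) (i j : Fin n) :
    MvPowerSeries.constantCoeff (gammaNumerator q c i j) = 1 :=
  constantCoeff_doubleShiftedFactorial (ρ := 1 / 2) hq1 (by norm_num) (by norm_num)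
    (C_mul_coratio_mem _ _ _ _) (by rw [map_mul, constantCoeff_coratio, mul_zero])

theorem constantCoeff_formalGamma (hq1 : ‖q‖ < 1) (c : ℂ) {i j : Fin n} (hij : i < j) :
    MvPowerSeries.constantCoeff (formalGamma q c i j) = 1 := by
  rw [formalGamma_eq, map_mul, MvPowerSeries.constantCoeff_inv, constantCoeff_gammaNumerator hq1,
    constantCoeff_gammaDenominator hq1 c hij, inv_one, mul_one]

open scoped MvPowerSeries.WithPiTopology in
theorem gammaDenominator_eq_mul (hq1 : ‖q‖ < 1) (c : ℂ) (i j : Fin n) :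
    gammaDenominator q c i j = shiftedFactorial (nome n) (MvPowerSeries.C c * ratio i j) *
      gammaDenominator q (q * c) i j := by
  rw [gammaDenominator, doubleShiftedFactorial_series_eq_mul (ρ := 1 / 2) hq1 (by norm_num)
    (by norm_num) (C_mul_ratio_mem _ _ _ _), gammaDenominator, map_mul, mul_assoc]

open scoped MvPowerSeries.WithPiTopology in
theorem gammaNumerator_eq_mul (hq1 : ‖q‖ < 1) (c : ℂ) (i j : Fin n) :
    gammaNumerator q c i j = shiftedFactorial (nome n) (MvPowerSeries.C c * coratio i j) *
      gammaNumerator q (q * c) i j := by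
  rw [gammaNumerator, doubleShiftedFactorial_series_eq_mul (ρ := 1 / 2) hq1 (by norm_num)
    (by norm_num) (C_mul_coratio_mem _ _ _ _), gammaNumerator, map_mul, mul_assoc]

open scoped MvPowerSeries.WithPiTopology in
/-- `Γ(q w; p, q) = θ(w; p) Γ(w; p, q)`. -/
theorem formalGamma_q_mul (hq0 : q ≠ 0) (hq1 : ‖q‖ < 1) (c : ℂ) {i j : Fin n}
    (hij : i < j) : formalGamma q (q * c) i j = formalTheta c i j * formalGamma q c i j := by
  have h : MvPowerSeries.constantCoeff (gammaDenominator q (q * c) i j) ≠ 0 := by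
    simp [constantCoeff_gammaDenominator hq1 _ hij]
  have h' : MvPowerSeries.constantCoeff (gammaDenominator q c i j) ≠ 0 := by
    simp [constantCoeff_gammaDenominator hq1 _ hij]
  rw [formalGamma_eq, eq_comm, MvPowerSeries.eq_mul_inv_iff_mul_eq h, formalGamma_eq, formalTheta]
  have e : q / (q * c) = c⁻¹ := by rw [div_mul_eq_div_div, div_self hq0, one_div]
  rw [e, gammaNumerator_eq_mul hq1 c⁻¹, ← div_eq_mul_inv q c]
  have h₁ := MvPowerSeries.mul_inv_cancel _ h'
  rw [gammaDenominator_eq_mul hq1 c] at h₁ ⊢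
  linear_combination (shiftedFactorial (nome n) (MvPowerSeries.C c⁻¹ * coratio i j) *
    gammaNumerator q (q / c) i j) * h₁

theorem qShiftHom_formalGamma (hq0 : q ≠ 0) (hq1 : ‖q‖ < 1) (I : Finset (Fin n)) (c : ℂ)
    {i j : Fin n} (hij : i < j) :
    qShiftHom q I (formalGamma q c i j) = formalGamma q (c * q ^ ratioExponent I i j) i j := by
  have h : MvPowerSeries.constantCoeff (gammaDenominator q c i j) ≠ 0 := by
    simp [constantCoeff_gammaDenominator hq1 _ hij]
  rw [formalGamma_eq, formalGamma_eq, map_mul, qShiftHom_inv I h, gammaDenominator, gammaNumerator,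
    qShiftHom_doubleShiftedFactorial I hq0 hq1 (ρ := 1 / 2) (by norm_num) (by norm_num)
      (C_mul_coratio_mem _ _ _ _),
    qShiftHom_doubleShiftedFactorial I hq0 hq1 (ρ := 1 / 2) (by norm_num) (by norm_num)
      (C_mul_ratio_mem _ _ _ _), map_mul, map_mul, qShiftHom_C, qShiftHom_C,
    qShiftHom_ratio I hq0 hij, qShiftHom_coratio I hq0 hij, ← mul_assoc, ← mul_assoc, ← map_mul,
    ← map_mul, ← div_eq_mul_inv, div_div, gammaDenominator, gammaNumerator]

/-- The factor `Γ(t x_j / x_i; p, q) / Γ(q x_j / (t x_i); p, q)`. -/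
def pairFactor (q t : ℂ) (i j : Fin n) : Series n :=
  formalGamma q t i j * (formalGamma q (q / t) i j)⁻¹

/-- The factor of `B_I(x; p)` that belongs to the pair `i < j`. -/
def pairCoefficient (t : ℂ) (I : Finset (Fin n)) (i j : Fin n) : Series n :=
  (if i ∈ I ∧ j ∉ I then formalTheta t⁻¹ i j * (formalTheta 1 i j)⁻¹ else 1) *
    if i ∉ I ∧ j ∈ I then formalTheta t i j * (formalTheta 1 i j)⁻¹ else 1

theorem coefficientB_eq_prod {n : ℕ} (t : ℂ) (I : Finset (Fin n)) :
    coefficientB t I = ∏ i, ∏ j ∈ Finset.Ioi i, pairCoefficient t I i j := by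
  have key : ∀ (u v : Finset (Fin n)) (g : Fin n → Fin n → Series n),
      ∏ i ∈ u, ∏ j ∈ v with i < j, g i j =
        ∏ i, ∏ j ∈ Finset.Ioi i, if i ∈ u ∧ j ∈ v then g i j else 1 := by
    intro u v g
    rw [← Finset.prod_subset (Finset.subset_univ u)]
    · refine Finset.prod_congr rfl fun i hi => ?_
      simp only [hi, true_and]
      rw [← Finset.prod_filter]
      refine Finset.prod_congr ?_ fun _ _ => rfl
      ext j
      simp [and_comm]
    · intro i _ hi
      exact Finset.prod_eq_one fun j _ => if_neg fun h => hi h.1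
  rw [coefficientB, key, key, ← Finset.prod_mul_distrib]
  refine Finset.prod_congr rfl fun i _ => ?_
  rw [← Finset.prod_mul_distrib]
  simp only [Finset.mem_compl]
  rfl

theorem pairCoefficient_mul_qShiftHom (hq0 : q ≠ 0) (hq1 : ‖q‖ < 1) {t : ℂ} (ht : t ≠ 0)
    (I : Finset (Fin n)) {i j : Fin n} (hij : i < j) :
    pairCoefficient (q / t) I i j * qShiftHom q I (pairFactor q t i j) =
      pairFactor q t i j * pairCoefficient t I i j := by
  have hG : ∀ c, MvPowerSeries.constantCoeff (formalGamma q c i j) ≠ 0 := fun c => by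
    simp [constantCoeff_formalGamma hq1 c hij]
  have hT : ∀ c, MvPowerSeries.constantCoeff (formalTheta c i j) ≠ 0 := fun c => by
    simp [constantCoeff_formalTheta c hij]
  rw [pairFactor, map_mul, qShiftHom_inv I (hG _), qShiftHom_formalGamma hq0 hq1 I _ hij,
    qShiftHom_formalGamma hq0 hq1 I _ hij, pairCoefficient, pairCoefficient]
  by_cases hi : i ∈ I <;> by_cases hj : j ∈ I
  · simp [hi, hj, ratioExponent]
  · have e₁ : formalGamma q t i j = formalTheta (t / q) i j * formalGamma q (t / q) i j := by
      rw [← formalGamma_q_mul hq0 hq1 _ hij, mul_div_cancel₀ _ hq0]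
    have e₂ : formalGamma q (q / t) i j = formalTheta t⁻¹ i j * formalGamma q t⁻¹ i j := by
      rw [← formalGamma_q_mul hq0 hq1 _ hij, div_eq_mul_inv]
    have e₃ : t * q ^ (-1 : ℤ) = t / q := by rw [zpow_neg_one, div_eq_mul_inv]
    have e₄ : q / t * q ^ (-1 : ℤ) = t⁻¹ := by rw [zpow_neg_one]; field_simp
    simp only [hi, hj, ratioExponent, not_true, not_false_iff, and_true, and_false,
      if_true, if_false, mul_one, zero_sub, e₃, e₄, inv_div]
    rw [e₁, e₂, MvPowerSeries.mul_inv_rev]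
    have := MvPowerSeries.mul_inv_cancel _ (hT t⁻¹)
    linear_combination -(formalTheta (t / q) i j * (formalTheta 1 i j)⁻¹ *
      formalGamma q (t / q) i j * (formalGamma q t⁻¹ i j)⁻¹) * this
  · have e₁ : formalGamma q (t * q) i j = formalTheta t i j * formalGamma q t i j := by
      rw [← formalGamma_q_mul hq0 hq1 _ hij, mul_comm]
    have e₂ : formalGamma q (q / t * q) i j =
        formalTheta (q / t) i j * formalGamma q (q / t) i j := by
      rw [← formalGamma_q_mul hq0 hq1 _ hij, mul_comm]
    simp only [hi, hj, ratioExponent, not_true, not_false_iff, and_true, and_false,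
      if_true, if_false, one_mul, sub_zero, zpow_one]
    rw [e₁, e₂, MvPowerSeries.mul_inv_rev]
    have := MvPowerSeries.mul_inv_cancel _ (hT (q / t))
    linear_combination (formalTheta t i j * (formalTheta 1 i j)⁻¹ *
      formalGamma q t i j * (formalGamma q (q / t) i j)⁻¹) * this
  · simp [hi, hj, ratioExponent]

theorem formalReflectionFactor_eq {n : ℕ} (q t : ℂ) :
    formalReflectionFactor n q t = ∏ i, ∏ j ∈ Finset.Ioi i, pairFactor q t i j := rfl

theorem coefficientB_mul_qShiftHom (hq0 : q ≠ 0) (hq1 : ‖q‖ < 1) {t : ℂ} (ht : t ≠ 0)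
    (I : Finset (Fin n)) :
    coefficientB (q / t) I * qShiftHom q I (formalReflectionFactor n q t) =
      formalReflectionFactor n q t * coefficientB t I := by
  simp only [coefficientB_eq_prod, formalReflectionFactor_eq, map_prod, ← Finset.prod_mul_distrib]
  exact Finset.prod_congr rfl fun i _ => Finset.prod_congr rfl fun j hj =>
    pairCoefficient_mul_qShiftHom hq0 hq1 ht I (Finset.mem_Ioi.1 hj)

theorem formalReflectionFactor_mul (hq0 : q ≠ 0) (hq1 : ‖q‖ < 1) (t : ℂ) :
    formalReflectionFactor n q t * formalReflectionFactor n q (q / t) = 1 := by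
  simp only [formalReflectionFactor_eq, ← Finset.prod_mul_distrib]
  refine Finset.prod_eq_one fun i _ => Finset.prod_eq_one fun j hj => ?_
  have hG : ∀ c, MvPowerSeries.constantCoeff (formalGamma q c i j) ≠ 0 := fun c => by
    simp [constantCoeff_formalGamma hq1 c (Finset.mem_Ioi.1 hj)]
  rw [pairFactor, pairFactor, div_div_cancel₀ hq0]
  have h₁ := MvPowerSeries.mul_inv_cancel _ (hG t)
  have h₂ := MvPowerSeries.mul_inv_cancel _ (hG (q / t))
  linear_combination (formalGamma q (q / t) i j * (formalGamma q (q / t) i j)⁻¹) * h₁ + h₂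

theorem constantCoeff_formalReflectionFactor (hq1 : ‖q‖ < 1) (t : ℂ) :
    MvPowerSeries.constantCoeff (formalReflectionFactor n q t) = 1 := by
  rw [formalReflectionFactor_eq, map_prod]
  refine Finset.prod_eq_one fun i _ => ?_
  rw [map_prod]
  refine Finset.prod_eq_one fun j hj => ?_
  rw [pairFactor, map_mul, MvPowerSeries.constantCoeff_inv,
    constantCoeff_formalGamma hq1 _ (Finset.mem_Ioi.1 hj),
    constantCoeff_formalGamma hq1 _ (Finset.mem_Ioi.1 hj), inv_one, mul_one]

theorem constantCoeff_coefficientB (t : ℂ) (I : Finset (Fin n)) :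
    MvPowerSeries.constantCoeff (coefficientB t I) = 1 := by
  rw [coefficientB_eq_prod, map_prod]
  refine Finset.prod_eq_one fun i _ => ?_
  rw [map_prod]
  refine Finset.prod_eq_one fun j hj => ?_
  have hT : ∀ c, MvPowerSeries.constantCoeff (formalTheta c i j) = 1 := fun c =>
    constantCoeff_formalTheta c (Finset.mem_Ioi.1 hj)
  rw [pairCoefficient, map_mul, apply_ite MvPowerSeries.constantCoeff,
    apply_ite MvPowerSeries.constantCoeff]
  simp [hT, MvPowerSeries.constantCoeff_inv]

end Factors

/-! ### Power series in the nome -/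

section Nome

variable {n : ℕ}

/-- The exponent of `p ^ m`. -/
def diag (n m : ℕ) : Fin n →₀ ℕ := Finsupp.equivFunOnFinite.symm fun _ => m

theorem diag_apply (m : ℕ) (i : Fin n) : diag n m i = m := rfl

theorem diag_add (l m : ℕ) : diag n (l + m) = diag n l + diag n m :=
  Finsupp.ext fun _ => rfl

theorem diag_zero : diag n 0 = 0 := Finsupp.ext fun _ => rfl

variable [NeZero n]

theorem diag_injective : Function.Injective (diag n) := fun l m h => by
  simpa [diag_apply] using DFunLike.congr_fun h (0 : Fin n)

theorem nome_pow {n : ℕ} (m : ℕ) : nome n ^ m = MvPowerSeries.monomial (diag n m) 1 := by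
  classical
  have h : ∀ u : Finset (Fin n), (∏ i ∈ u, MvPowerSeries.X i : Series n) =
      MvPowerSeries.monomial (∑ i ∈ u, Finsupp.single i 1) 1 := fun u => by
    induction u using Finset.induction with
    | empty => simp
    | insert a u ha ih =>
      rw [Finset.prod_insert ha, Finset.sum_insert ha, ih, MvPowerSeries.X,
        MvPowerSeries.monomial_mul_monomial, one_mul]
  rw [nome, h, MvPowerSeries.monomial_pow, one_pow]
  congr 2
  ext i
  simp [diag_apply, Finsupp.single_apply]

theorem hasSubst_nome : PowerSeries.HasSubst (nome n) := by
  refine PowerSeries.HasSubst.of_constantCoeff_zero ?_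
  rw [nome, map_prod]
  exact Finset.prod_eq_zero (Finset.mem_univ 0) (MvPowerSeries.constantCoeff_X 0)

theorem coeff_ofNome [DecidableEq (Fin n →₀ ℕ)] (g : PowerSeries ℂ) (k : Fin n →₀ ℕ) :
    MvPowerSeries.coeff k (ofNome n g) =
      if k = diag n (k 0) then PowerSeries.coeff (k 0) g else 0 := by
  rw [ofNome, PowerSeries.coeff_subst hasSubst_nome]
  simp only [nome_pow, MvPowerSeries.coeff_monomial]
  rw [finsum_eq_single _ (k 0)]
  · simp
  · intro m hm
    rw [if_neg, smul_zero]
    rintro rfl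
    exact hm rfl

theorem coeff_diag_ofNome (g : PowerSeries ℂ) (m : ℕ) :
    MvPowerSeries.coeff (diag n m) (ofNome n g) = PowerSeries.coeff m g := by
  classical
  rw [coeff_ofNome, diag_apply, if_pos rfl]

theorem constantCoeff_ofNome (g : PowerSeries ℂ) :
    MvPowerSeries.constantCoeff (ofNome n g) = PowerSeries.coeff 0 g := by
  rw [← coeff_diag_ofNome (n := n), diag_zero, MvPowerSeries.coeff_zero_eq_constantCoeff_apply]

theorem coeff_ofNome_of_ne {g : PowerSeries ℂ} {k : Fin n →₀ ℕ} (hk : ∀ m, k ≠ diag n m) :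
    MvPowerSeries.coeff k (ofNome n g) = 0 := by
  classical
  rw [coeff_ofNome, if_neg (hk _)]

theorem ofNome_mul (g h : PowerSeries ℂ) : ofNome n (g * h) = ofNome n g * ofNome n h :=
  PowerSeries.subst_mul hasSubst_nome g h

theorem ofNome_sub (g h : PowerSeries ℂ) : ofNome n (g - h) = ofNome n g - ofNome n h :=
  PowerSeries.subst_sub hasSubst_nome g h

theorem ofNome_one : ofNome n 1 = 1 := by
  rw [ofNome, ← PowerSeries.coe_substAlgHom hasSubst_nome, map_one]

theorem qShiftHom_ofNome (q : ℂ) (I : Finset (Fin n)) (hq : q ≠ 0) (g : PowerSeries ℂ) :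
    qShiftHom q I (ofNome n g) = ofNome n g := by
  ext k
  by_cases hk : ∀ m, k ≠ diag n m
  · rw [qShiftHom, MvPowerSeries.coeff_rescale, coeff_ofNome_of_ne hk, mul_zero]
  · push Not at hk
    obtain ⟨m, rfl⟩ := hk
    rw [← qShift_eq I hq]
    change (∏ i ∈ I, q ^ ((m : ℤ) - (m : ℤ))) * MvPowerSeries.coeff (diag n m) (ofNome n g) = _
    simp

/-- The constant term of `f` with respect to `x`. -/
def diagonal (f : Series n) : PowerSeries ℂ :=
  PowerSeries.mk fun m => MvPowerSeries.coeff (diag n m) f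

theorem coeff_diagonal {n : ℕ} (f : Series n) (m : ℕ) :
    PowerSeries.coeff m (diagonal f) = MvPowerSeries.coeff (diag n m) f :=
  PowerSeries.coeff_mk _ _

theorem constantCoeff_diagonal {n : ℕ} (f : Series n) :
    PowerSeries.constantCoeff (diagonal f) = MvPowerSeries.constantCoeff f := by
  rw [← PowerSeries.coeff_zero_eq_constantCoeff_apply, coeff_diagonal, diag_zero,
    MvPowerSeries.coeff_zero_eq_constantCoeff_apply]

theorem diagonal_ofNome_mul (g : PowerSeries ℂ) (f : Series n) :
    diagonal (ofNome n g * f) = g * diagonal f := by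
  classical
  ext m
  rw [coeff_diagonal, MvPowerSeries.coeff_mul, PowerSeries.coeff_mul]
  symm
  refine Finset.sum_of_injOn (fun x => (diag n x.1, diag n x.2)) ?_ ?_ ?_ ?_
  · intro x _ y _ h
    exact Prod.ext (diag_injective (Prod.ext_iff.1 h).1) (diag_injective (Prod.ext_iff.1 h).2)
  · intro x hx
    simp only [Finset.mem_coe, Finset.HasAntidiagonal.mem_antidiagonal] at hx ⊢
    rw [← diag_add, hx]
  · intro x hx hx'
    rw [Finset.HasAntidiagonal.mem_antidiagonal] at hx
    rw [coeff_ofNome_of_ne, zero_mul]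
    intro l hl
    refine hx' ⟨(l, x.2 0), ?_, ?_⟩
    · have := DFunLike.congr_fun hx 0
      simpa [hl, diag_apply] using this
    · refine Prod.ext hl.symm (Finsupp.ext fun i => ?_)
      have h₀ := DFunLike.congr_fun hx 0
      have h₁ := DFunLike.congr_fun hx i
      simp only [hl, diag_apply, Finsupp.add_apply] at h₀ h₁ ⊢
      omega
  · intro x _
    rw [coeff_diag_ofNome, coeff_diagonal]

theorem normalized_iff {n : ℕ} (f : Series n) :
    (∀ m : ℕ, MvPowerSeries.coeff (Finsupp.equivFunOnFinite.symm fun _ : Fin n => m) f =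
      if m = 0 then 1 else 0) ↔ diagonal f = 1 := by
  rw [PowerSeries.ext_iff]
  refine forall_congr' fun m => ?_
  rw [coeff_diagonal, PowerSeries.coeff_one]
  rfl

end Nome

/-! ### Uniqueness of the eigenfunction -/

section Uniqueness

variable {n : ℕ} [NeZero n] {q t : ℂ} {s : Fin n → ℂ}

theorem modifiedOperator_eq (hq0 : q ≠ 0) (r : ℕ) (f : Series n) :
    modifiedOperator q t s r f = ∑ I ∈ Finset.powersetCard r Finset.univ,
      MvPowerSeries.C (∏ i ∈ I, s i) * coefficientB t I * qShiftHom q I f := by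
  simp only [modifiedOperator, qShift_eq _ hq0]

theorem modifiedOperator_sub (hq0 : q ≠ 0) (r : ℕ) (f g : Series n) :
    modifiedOperator q t s r (f - g) = modifiedOperator q t s r f - modifiedOperator q t s r g := by
  simp only [modifiedOperator_eq hq0, map_sub, mul_sub, Finset.sum_sub_distrib]

/-- The coefficient at `z ^ k` of a product, if the coefficients of `g` below `k` vanish. -/
theorem coeff_mul_of_coeff_eq_zero {n : ℕ} {f g : Series n} {k : Fin n →₀ ℕ}
    (hg : ∀ l < k, MvPowerSeries.coeff l g = 0) :
    MvPowerSeries.coeff k (f * g) = MvPowerSeries.constantCoeff f * MvPowerSeries.coeff k g := by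
  classical
  rw [MvPowerSeries.coeff_mul, Finset.sum_eq_single (0, k)]
  · simp
  · intro x hx hne
    rw [Finset.HasAntidiagonal.mem_antidiagonal] at hx
    have hle : x.2 ≤ k := hx ▸ le_add_self
    rcases hle.eq_or_lt with h | h
    · refine absurd (Prod.ext ?_ h) hne
      rw [h] at hx
      simpa using hx
    · rw [hg _ h, mul_zero]
  · simp

/-- The leading coefficient of the operator of order `r` at `z ^ k`. -/
def leadingCoeff (q : ℂ) (s : Fin n → ℂ) (r : ℕ) (k : Fin n → ℕ) : ℂ :=
  ∑ I ∈ Finset.powersetCard r Finset.univ, ∏ i ∈ I, s i * q ^ ((k i : ℤ) - (k (i + 1) : ℤ))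

theorem coeff_modifiedOperator (r : ℕ) {g : Series n} {k : Fin n →₀ ℕ}
    (hg : ∀ l < k, MvPowerSeries.coeff l g = 0) :
    MvPowerSeries.coeff k (modifiedOperator q t s r g) =
      leadingCoeff q s r k * MvPowerSeries.coeff k g := by
  rw [modifiedOperator, map_sum, leadingCoeff, Finset.sum_mul]
  refine Finset.sum_congr rfl fun I _ => ?_
  have h : ∀ l, MvPowerSeries.coeff l (qShift q I g) =
      (∏ i ∈ I, q ^ ((l i : ℤ) - (l (i + 1) : ℤ))) * MvPowerSeries.coeff l g := fun l => rfl
  rw [coeff_mul_of_coeff_eq_zero fun l hl => by rw [h, hg l hl, mul_zero], map_mul,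
    constantCoeff_coefficientB, MvPowerSeries.constantCoeff_C, h, Finset.prod_mul_distrib]
  ring

theorem prod_one_add_mul_eq_sum (x : ℂ) (k : Fin n → ℕ) :
    ∏ i, (1 + x * (s i * q ^ ((k i : ℤ) - (k (i + 1) : ℤ)))) =
      ∑ r ∈ Finset.range (n + 1), x ^ r * leadingCoeff q s r k := by
  rw [Finset.prod_one_add, Finset.sum_powerset, Finset.card_univ, Fintype.card_fin]
  refine Finset.sum_congr rfl fun r _ => ?_
  rw [leadingCoeff, Finset.mul_sum]
  refine Finset.sum_congr rfl fun I hI => ?_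
  rw [Finset.prod_mul_distrib, Finset.prod_const, (Finset.mem_powersetCard.1 hI).2]

theorem eq_diag_of_forall_eq_add_one {k : Fin n →₀ ℕ} (h : ∀ i, k i = k (i + 1)) :
    k = diag n (k 0) := by
  have key : ∀ d, ∀ i : Fin n, (i : ℕ) = d → k i = k 0 := by
    intro d
    induction d with
    | zero =>
      intro i hi
      rw [Fin.ext (a := i) (b := 0) (by simpa using hi)]
    | succ d ih =>
      intro i hi
      have h0 : i ≠ 0 := by
        rintro rfl
        simp at hi
      have := h (i - 1)
      rw [sub_add_cancel] at this
      rw [← this]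
      exact ih _ (by rw [Fin.val_sub_one_of_ne_zero h0]; omega)
  exact Finsupp.ext fun i => key i i rfl

theorem zpow_ne_one (hq0 : q ≠ 0) (hq1 : ‖q‖ < 1) {m : ℤ} (hm : m ≠ 0) : q ^ m ≠ 1 := by
  intro h
  have h' : ‖q‖ ^ m = ‖q‖ ^ (0 : ℤ) := by rw [← norm_zpow, h]; simp
  exact hm ((zpow_right_injective₀ (norm_pos_iff.2 hq0) hq1.ne) h')

/-- The leading coefficients determine the exponents up to powers of `p`. -/
theorem eq_diag_of_leadingCoeff_eq (hq0 : q ≠ 0) (hq1 : ‖q‖ < 1) (hs0 : ∀ i, s i ≠ 0)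
    (hs : ∀ i j : Fin n, i < j → ∀ m : ℤ, m ≠ 0 → s j / s i ≠ q ^ m) {k : Fin n →₀ ℕ}
    (h : ∀ r, 1 ≤ r → r ≤ n → leadingCoeff q s r k = leadingCoeff q s r (0 : Fin n →₀ ℕ)) :
    k = diag n (k 0) := by
  have hprod : ∀ x : ℂ, ∏ i, (1 + x * (s i * q ^ ((k i : ℤ) - (k (i + 1) : ℤ)))) =
      ∏ i, (1 + x * s i) := by
    intro x
    have h0 := prod_one_add_mul_eq_sum (q := q) (s := s) x (0 : Fin n →₀ ℕ)
    simp only [Finsupp.coe_zero, Pi.zero_apply, sub_self, zpow_zero, mul_one] at h0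
    rw [h0, prod_one_add_mul_eq_sum]
    refine Finset.sum_congr rfl fun r hr => ?_
    rcases Nat.eq_zero_or_pos r with rfl | hr0
    · simp [leadingCoeff]
    · rw [h r hr0 (by simpa [Nat.lt_succ_iff] using hr)]
      rfl
  refine eq_diag_of_forall_eq_add_one fun i => ?_
  by_contra hne
  set m : ℤ := (k i : ℤ) - (k (i + 1) : ℤ) with hm
  have hm0 : m ≠ 0 := by omega
  have hu : s i * q ^ m ≠ 0 := mul_ne_zero (hs0 i) (zpow_ne_zero _ hq0)
  have h1 := hprod (-(s i * q ^ m)⁻¹)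
  rw [Finset.prod_eq_zero (Finset.mem_univ i) (by rw [← hm, neg_mul, inv_mul_cancel₀ hu]; ring),
    eq_comm, Finset.prod_eq_zero_iff] at h1
  obtain ⟨j, -, hj⟩ := h1
  have hj' : s j = s i * q ^ m := by
    have := mul_inv_cancel₀ hu
    linear_combination -s j * this - (s i * q ^ m) * hj
  rcases lt_trichotomy i j with hij | rfl | hij
  · exact hs i j hij m hm0 (by rw [hj', mul_div_cancel_left₀ _ (hs0 i)])
  · exact zpow_ne_one hq0 hq1 hm0 (mul_left_cancel₀ (hs0 i) (by rw [← hj', mul_one]))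
  · refine hs j i hij (-m) (neg_ne_zero.2 hm0) ?_
    rw [hj', zpow_neg, div_mul_eq_div_div, div_self (hs0 i), one_div]

theorem constantCoeff_eq_one {f : Series n} {ε : ℕ → PowerSeries ℂ}
    (hf : IsRuijsenaarsFunction q t s f ε) : MvPowerSeries.constantCoeff f = 1 := by
  rw [← MvPowerSeries.coeff_zero_eq_constantCoeff_apply, ← diag_zero]
  exact hf.normalized 0

theorem diagonal_eq_one {f : Series n} {ε : ℕ → PowerSeries ℂ}
    (hf : IsRuijsenaarsFunction q t s f ε) : diagonal f = 1 :=
  (normalized_iff f).1 hf.normalized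

theorem coeff_zero_eigenvalue {f : Series n} {ε : ℕ → PowerSeries ℂ}
    (hf : IsRuijsenaarsFunction q t s f ε) {r : ℕ} (h1 : 1 ≤ r) (hr : r ≤ n) :
    PowerSeries.coeff 0 (ε r) = leadingCoeff q s r (0 : Fin n →₀ ℕ) := by
  have h := congrArg (MvPowerSeries.coeff 0) (hf.eigen r h1 hr)
  rw [coeff_modifiedOperator r fun l hl => absurd hl not_lt_zero,
    coeff_mul_of_coeff_eq_zero fun l hl => absurd hl not_lt_zero,
    MvPowerSeries.coeff_zero_eq_constantCoeff_apply, constantCoeff_eq_one hf,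
    constantCoeff_ofNome] at h
  simpa using h.symm

theorem unique (hq0 : q ≠ 0) (hq1 : ‖q‖ < 1) (hs0 : ∀ i, s i ≠ 0)
    (hs : ∀ i j : Fin n, i < j → ∀ m : ℤ, m ≠ 0 → s j / s i ≠ q ^ m)
    {f f' : Series n} {ε ε' : ℕ → PowerSeries ℂ} (hf : IsRuijsenaarsFunction q t s f ε)
    (hf' : IsRuijsenaarsFunction q t s f' ε') :
    f' = f ∧ ∀ r, 1 ≤ r → r ≤ n → ε' r = ε r := by
  have key : ∀ k : Fin n →₀ ℕ, MvPowerSeries.coeff k (f' - f) = 0 ∧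
      ∀ r, 1 ≤ r → r ≤ n → MvPowerSeries.coeff k (ofNome n (ε' r - ε r)) = 0 := by
    intro k
    induction k using WellFoundedLT.induction with
    | ind k ih =>
    have hg : ∀ l < k, MvPowerSeries.coeff l (f' - f) = 0 := fun l hl => (ih l hl).1
    have main : ∀ r, 1 ≤ r → r ≤ n →
        leadingCoeff q s r k * MvPowerSeries.coeff k (f' - f) =
          leadingCoeff q s r (0 : Fin n →₀ ℕ) * MvPowerSeries.coeff k (f' - f) +
            MvPowerSeries.coeff k (ofNome n (ε' r - ε r)) := by
      intro r h1 hr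
      have e : modifiedOperator q t s r (f' - f) =
          ofNome n (ε' r) * (f' - f) + f * ofNome n (ε' r - ε r) := by
        rw [modifiedOperator_sub hq0, hf.eigen r h1 hr, hf'.eigen r h1 hr, ofNome_sub]
        ring
      have h := congrArg (MvPowerSeries.coeff k) e
      rwa [coeff_modifiedOperator r hg, map_add, coeff_mul_of_coeff_eq_zero hg,
        coeff_mul_of_coeff_eq_zero fun l hl => (ih l hl).2 r h1 hr, constantCoeff_eq_one hf,
        one_mul, constantCoeff_ofNome, coeff_zero_eigenvalue hf' h1 hr] at h
    by_cases hk : ∃ m, k = diag n m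
    · obtain ⟨m, rfl⟩ := hk
      have h0 : MvPowerSeries.coeff (diag n m) (f' - f) = 0 := by
        rw [map_sub, ← coeff_diagonal, ← coeff_diagonal, diagonal_eq_one hf, diagonal_eq_one hf',
          sub_self]
      refine ⟨h0, fun r h1 hr => ?_⟩
      simpa [h0] using (main r h1 hr).symm
    · push Not at hk
      refine ⟨?_, fun r _ _ => coeff_ofNome_of_ne hk⟩
      by_contra h0
      refine hk _ (eq_diag_of_leadingCoeff_eq hq0 hq1 hs0 hs fun r h1 hr => ?_)
      have h := main r h1 hr
      rw [coeff_ofNome_of_ne hk, add_zero] at h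
      exact mul_right_cancel₀ h0 h
  refine ⟨sub_eq_zero.1 (MvPowerSeries.ext fun k => by simpa using (key k).1), fun r h1 hr => ?_⟩
  refine sub_eq_zero.1 (PowerSeries.ext fun m => ?_)
  rw [← coeff_diag_ofNome (n := n), (key _).2 r h1 hr, map_zero]

end Uniqueness

/-! ### The reflected eigenfunction -/

section Reflection

variable {n : ℕ} [NeZero n] {q t : ℂ} {s : Fin n → ℂ}

theorem isRuijsenaarsFunction_transform (hq0 : q ≠ 0) (hq1 : ‖q‖ < 1) (ht : t ≠ 0)
    {f : Series n} {ε : ℕ → PowerSeries ℂ} (hf : IsRuijsenaarsFunction q t s f ε)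
    {g : PowerSeries ℂ} (hg : g * diagonal (formalReflectionFactor n q t * f) = 1) :
    IsRuijsenaarsFunction q (q / t) s (ofNome n g * formalReflectionFactor n q t * f) ε where
  eigen r h1 hr := by
    have h := hf.eigen r h1 hr
    rw [modifiedOperator_eq hq0] at h ⊢
    rw [mul_left_comm, ← h, Finset.mul_sum]
    refine Finset.sum_congr rfl fun I _ => ?_
    rw [map_mul, map_mul, qShiftHom_ofNome q I hq0]
    linear_combination (MvPowerSeries.C (∏ i ∈ I, s i) * ofNome n g * qShiftHom q I f) *
      coefficientB_mul_qShiftHom hq0 hq1 ht I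
  normalized := by
    rw [normalized_iff, mul_assoc, diagonal_ofNome_mul, hg]

open scoped Classical in
/-- The factor `γ(s; p | q, t)`, equal to `1` if there is no eigenfunction for `t`. -/
def normalization (q : ℂ) (s : Fin n → ℂ) (t : ℂ) : PowerSeries ℂ :=
  if h : ∃ f ε, IsRuijsenaarsFunction q t s f ε then
    (diagonal (formalReflectionFactor n q t * h.choose))⁻¹
  else 1

theorem constantCoeff_diagonal_reflection (hq1 : ‖q‖ < 1) {f : Series n}
    {ε : ℕ → PowerSeries ℂ} (hf : IsRuijsenaarsFunction q t s f ε) :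
    PowerSeries.constantCoeff (diagonal (formalReflectionFactor n q t * f)) = 1 := by
  rw [constantCoeff_diagonal, map_mul, constantCoeff_formalReflectionFactor hq1,
    constantCoeff_eq_one hf, mul_one]

theorem normalization_mul_diagonal (hq0 : q ≠ 0) (hq1 : ‖q‖ < 1) (hs0 : ∀ i, s i ≠ 0)
    (hs : ∀ i j : Fin n, i < j → ∀ m : ℤ, m ≠ 0 → s j / s i ≠ q ^ m)
    {f : Series n} {ε : ℕ → PowerSeries ℂ} (hf : IsRuijsenaarsFunction q t s f ε) :
    normalization q s t * diagonal (formalReflectionFactor n q t * f) = 1 := by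
  have h : ∃ f ε, IsRuijsenaarsFunction q t s f ε := ⟨f, ε, hf⟩
  obtain ⟨ε', hε'⟩ := h.choose_spec
  rw [normalization, dif_pos h, (unique hq0 hq1 hs0 hs hε' hf).1]
  exact PowerSeries.inv_mul_cancel _ (by simp [constantCoeff_diagonal_reflection hq1 hε'])

theorem exists_reflection (hq0 : q ≠ 0) (hq1 : ‖q‖ < 1) (hs0 : ∀ i, s i ≠ 0)
    (hs : ∀ i j : Fin n, i < j → ∀ m : ℤ, m ≠ 0 → s j / s i ≠ q ^ m) (ht : t ≠ 0)
    (h : ∃ f ε, IsRuijsenaarsFunction q t s f ε) :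
    ∃ f ε, IsRuijsenaarsFunction q (q / t) s f ε := by
  obtain ⟨f, ε, hf⟩ := h
  exact ⟨_, ε, isRuijsenaarsFunction_transform hq0 hq1 ht hf
    (normalization_mul_diagonal hq0 hq1 hs0 hs hf)⟩

theorem normalization_mul (hq0 : q ≠ 0) (hq1 : ‖q‖ < 1) (hs0 : ∀ i, s i ≠ 0)
    (hs : ∀ i j : Fin n, i < j → ∀ m : ℤ, m ≠ 0 → s j / s i ≠ q ^ m) (ht : t ≠ 0) :
    normalization q s t * normalization q s (q / t) = 1 := by
  by_cases h : ∃ f ε, IsRuijsenaarsFunction q t s f ε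
  · obtain ⟨f, ε, hf⟩ := h
    have h' := normalization_mul_diagonal hq0 hq1 hs0 hs
      (isRuijsenaarsFunction_transform hq0 hq1 ht hf
        (normalization_mul_diagonal hq0 hq1 hs0 hs hf))
    have e : formalReflectionFactor n q (q / t) *
        (ofNome n (normalization q s t) * formalReflectionFactor n q t * f) =
        ofNome n (normalization q s t) * f := by
      linear_combination (ofNome n (normalization q s t) * f) *
        formalReflectionFactor_mul (n := n) hq0 hq1 t
    rw [e, diagonal_ofNome_mul, diagonal_eq_one hf, mul_one] at h'
    rw [mul_comm, h']
  · have h' : ¬∃ f ε, IsRuijsenaarsFunction q (q / t) s f ε := fun h' => h (by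
      simpa [div_div_cancel₀ hq0] using
        exists_reflection hq0 hq1 hs0 hs (div_ne_zero hq0 ht) h')
    rw [normalization, normalization, dif_neg h, dif_neg h', mul_one]

end Reflection

/-! ### Convergence near the origin -/

section Convergence

open Filter Topology

variable {n : ℕ}

theorem norm_weighted_le {ρ ρ₀ : ℝ} (hρ : 0 ≤ ρ) (h : ρ ≤ ρ₀) (f : Series n) (k : Fin n →₀ ℕ) :
    ‖weighted ρ f k‖ ≤ ‖weighted ρ₀ f k‖ := by
  rw [weighted, weighted, norm_mul, norm_mul, norm_pow, norm_pow]
  gcongr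
  simpa [abs_of_nonneg hρ, abs_of_nonneg (hρ.trans h)] using h

/-- The ring of series that converge absolutely near the origin. -/
def convergentGerms (n : ℕ) : Subring (Series n) where
  carrier := {f | ∀ᶠ ρ in 𝓝[>] (0 : ℝ), f ∈ convergentSubring n ρ}
  mul_mem' {f g} hf hg := by
    rw [Set.mem_ofPred_eq] at *
    exact (hf.and hg).mono fun _ h => Subring.mul_mem _ h.1 h.2
  one_mem' := by
    rw [Set.mem_ofPred_eq]
    exact Eventually.of_forall fun _ => Subring.one_mem _
  add_mem' {f g} hf hg := by
    rw [Set.mem_ofPred_eq] at *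
    exact (hf.and hg).mono fun _ h => Subring.add_mem _ h.1 h.2
  zero_mem' := by
    rw [Set.mem_ofPred_eq]
    exact Eventually.of_forall fun _ => Subring.zero_mem _
  neg_mem' {f} hf := by
    rw [Set.mem_ofPred_eq] at *
    exact hf.mono fun _ h => Subring.neg_mem _ h

theorem mem_convergentGerms {f : Series n} :
    f ∈ convergentGerms n ↔ ∀ᶠ ρ in 𝓝[>] (0 : ℝ), f ∈ convergentSubring n ρ := Iff.rfl

theorem mem_convergentGerms_of_mem {f : Series n} {ρ₀ : ℝ} (h₀ : 0 < ρ₀)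
    (hf : f ∈ convergentSubring n ρ₀) : f ∈ convergentGerms n := by
  rw [mem_convergentGerms]
  filter_upwards [Ioo_mem_nhdsGT h₀] with ρ hρ
  exact Summable.of_nonneg_of_le (fun _ => norm_nonneg _)
    (norm_weighted_le hρ.1.le hρ.2.le f) hf

theorem mem_convergentGerms_of_isConvergent {f : Series n} (hf : IsConvergent f) :
    f ∈ convergentGerms n := by
  obtain ⟨r, hr, h⟩ := hf
  refine mem_convergentGerms_of_mem (half_pos hr) ?_
  have h' := h (fun _ => ((r / 2 : ℝ) : ℂ)) fun _ => by
    rw [Complex.norm_real, Real.norm_of_nonneg (half_pos hr).le]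
    linarith
  rw [mem_convergentSubring]
  simpa only [weighted, termAt, Finset.prod_pow_eq_pow_sum, ← Finsupp.degree_eq_sum] using h'

theorem norm_weighted_le_of_constantCoeff_eq_zero {ρ ρ₀ : ℝ} (hρ : 0 ≤ ρ) (h₀ : 0 < ρ₀)
    (h : ρ ≤ ρ₀) {f : Series n} (hf : MvPowerSeries.constantCoeff f = 0) (k : Fin n →₀ ℕ) :
    ‖weighted ρ f k‖ ≤ ρ / ρ₀ * ‖weighted ρ₀ f k‖ := by
  rcases eq_or_ne k 0 with rfl | hk
  · simp [weighted, hf]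
  · have hd : k.degree ≠ 0 := fun h => hk ((Finsupp.degree_eq_zero_iff k).1 h)
    have e : ρ ^ k.degree ≤ ρ / ρ₀ * ρ₀ ^ k.degree := by
      rw [← div_le_iff₀ (pow_pos h₀ _), ← div_pow]
      exact pow_le_of_le_one (by positivity) ((div_le_one h₀).2 h) hd
    simp only [weighted, norm_mul, norm_pow, Complex.norm_real, Real.norm_of_nonneg hρ,
      Real.norm_of_nonneg h₀.le]
    calc _ ≤ ‖MvPowerSeries.coeff k f‖ * (ρ / ρ₀ * ρ₀ ^ k.degree) := by gcongr
      _ = _ := by ring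

theorem inv_mem_convergentGerms {f : Series n} (hf : f ∈ convergentGerms n)
    (hf1 : MvPowerSeries.constantCoeff f = 1) : f⁻¹ ∈ convergentGerms n := by
  obtain ⟨ρ₀, hf₀, h₀⟩ :=
    ((mem_convergentGerms.1 hf).and (eventually_mem_nhdsWithin (s := Set.Ioi 0))).exists
  rw [Set.mem_Ioi] at h₀
  have hg₀ : 1 - f ∈ convergentSubring n ρ₀ := Subring.sub_mem _ (Subring.one_mem _) hf₀
  have hc : MvPowerSeries.constantCoeff (1 - f) = 0 := by simp [hf1]
  set N : ℝ := ∑' k, ‖weighted ρ₀ (1 - f) k‖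
  have hN : 0 ≤ N := tsum_nonneg fun _ => norm_nonneg _
  rw [mem_convergentGerms]
  filter_upwards [Ioo_mem_nhdsGT (show 0 < ρ₀ / (N + 1) by positivity)] with ρ hρ
  have := Fact.mk hρ.1
  have hle : ρ ≤ ρ₀ := hρ.2.le.trans (div_le_self h₀.le (by linarith))
  have hb := norm_weighted_le_of_constantCoeff_eq_zero hρ.1.le h₀ hle hc
  have hg : 1 - f ∈ convergentSubring n ρ :=
    Summable.of_nonneg_of_le (fun _ => norm_nonneg _) hb (hg₀.mul_left _)
  have hlt : ‖ConvergentSeries.mk (1 - f) hg‖ < 1 := by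
    refine (norm_def _).trans_lt ?_
    refine (hg.tsum_le_tsum hb (hg₀.mul_left _)).trans_lt ?_
    rw [tsum_mul_left, div_mul_eq_mul_div, div_lt_one h₀]
    have h1 := (lt_div_iff₀ (by linarith)).1 hρ.2
    linarith [hρ.1]
  have hu := congrArg (ConvergentSeries.toSeries n ρ) (Units.oneSub _ hlt).inv_mul
  rw [map_mul, map_one, Units.val_oneSub, map_sub, map_one, ConvergentSeries.toSeries_mk,
    sub_sub_cancel, ← MvPowerSeries.eq_inv_iff_mul_eq_one (by simp [hf1])] at hu
  rw [← hu]
  exact Subtype.property _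

theorem value_inv {ρ : ℝ} {z : Fin n → ℂ} (hz : ∀ i, ‖z i‖ ≤ ρ) {f : Series n}
    (hf : f ∈ convergentSubring n ρ) (hf' : f⁻¹ ∈ convergentSubring n ρ)
    (h : MvPowerSeries.constantCoeff f ≠ 0) : value z f⁻¹ = (value z f)⁻¹ := by
  refine eq_inv_of_mul_eq_one_left ?_
  rw [← value_mul hz hf' hf, MvPowerSeries.inv_mul_cancel _ h]
  simpa using value_C z 1

variable [NeZero n] {q : ℂ}

theorem ofNome_diagonal_mem_convergentGerms {f : Series n} (hf : f ∈ convergentGerms n) :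
    ofNome n (diagonal f) ∈ convergentGerms n := by
  rw [mem_convergentGerms]
  filter_upwards [mem_convergentGerms.1 hf] with ρ hρ
  refine Summable.of_nonneg_of_le (fun _ => norm_nonneg _) (fun k => ?_) hρ
  by_cases hk : ∃ m, k = diag n m
  · obtain ⟨m, rfl⟩ := hk
    rw [weighted, coeff_diag_ofNome, coeff_diagonal, weighted]
  · push Not at hk
    rw [weighted, coeff_ofNome_of_ne hk, zero_mul, norm_zero]
    exact norm_nonneg _

theorem gammaDenominator_mem {ρ : ℝ} (hq1 : ‖q‖ < 1) (hρ : 0 < ρ) (hρ1 : ρ < 1) (c : ℂ)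
    (i j : Fin n) : gammaDenominator q c i j ∈ convergentSubring n ρ :=
  doubleShiftedFactorial_mem_convergentSubring hq1 hρ hρ1 (C_mul_ratio_mem _ _ _ _)

theorem gammaNumerator_mem {ρ : ℝ} (hq1 : ‖q‖ < 1) (hρ : 0 < ρ) (hρ1 : ρ < 1) (c : ℂ)
    (i j : Fin n) : gammaNumerator q c i j ∈ convergentSubring n ρ :=
  doubleShiftedFactorial_mem_convergentSubring hq1 hρ hρ1 (C_mul_coratio_mem _ _ _ _)

theorem inv_gammaDenominator_mem_convergentGerms (hq1 : ‖q‖ < 1) (c : ℂ) {i j : Fin n}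
    (hij : i < j) : (gammaDenominator q c i j)⁻¹ ∈ convergentGerms n :=
  inv_mem_convergentGerms (mem_convergentGerms_of_mem (ρ₀ := 1 / 2) (by norm_num)
    (gammaDenominator_mem hq1 (by norm_num) (by norm_num) c i j))
    (constantCoeff_gammaDenominator hq1 c hij)

theorem formalGamma_mem_convergentGerms (hq1 : ‖q‖ < 1) (c : ℂ) {i j : Fin n}
    (hij : i < j) : formalGamma q c i j ∈ convergentGerms n :=
  Subring.mul_mem _ (mem_convergentGerms_of_mem (ρ₀ := 1 / 2) (by norm_num)
    (gammaNumerator_mem hq1 (by norm_num) (by norm_num) (q / c) i j))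
    (inv_gammaDenominator_mem_convergentGerms hq1 c hij)

theorem inv_formalGamma_mem_convergentGerms (hq1 : ‖q‖ < 1) (c : ℂ) {i j : Fin n}
    (hij : i < j) : (formalGamma q c i j)⁻¹ ∈ convergentGerms n :=
  inv_mem_convergentGerms (formalGamma_mem_convergentGerms hq1 c hij)
    (constantCoeff_formalGamma hq1 c hij)

theorem pairFactor_mem_convergentGerms (hq1 : ‖q‖ < 1) (t : ℂ) {i j : Fin n}
    (hij : i < j) : pairFactor q t i j ∈ convergentGerms n :=
  Subring.mul_mem _ (formalGamma_mem_convergentGerms hq1 t hij)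
    (inv_formalGamma_mem_convergentGerms hq1 (q / t) hij)

theorem formalReflectionFactor_mem_convergentGerms (hq1 : ‖q‖ < 1) (t : ℂ) :
    formalReflectionFactor n q t ∈ convergentGerms n :=
  Subring.prod_mem _ fun _ _ => Subring.prod_mem _ fun _ hj =>
    pairFactor_mem_convergentGerms hq1 t (Finset.mem_Ioi.1 hj)

end Convergence

/-! ### Values in the asymptotic domain -/

section Values

open Filter Topology

variable {n : ℕ} [NeZero n] {p q : ℂ} {x : Fin n → ℂ}

theorem prod_zCoord (hx : ∀ i, x i ≠ 0) : ∏ m, zCoord p x m = p := by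
  have h := Equiv.prod_comp (Equiv.subRight (1 : Fin n)) x
  simp only [Equiv.subRight_apply] at h
  have h0 : ∏ m, x m ≠ 0 := Finset.prod_ne_zero_iff.2 fun m _ => hx m
  simp only [zCoord, mul_div_assoc, Finset.prod_mul_distrib, Finset.prod_div_distrib]
  rw [h, div_self h0, Finset.prod_ite_eq' Finset.univ (0 : Fin n) fun _ => p]
  simp

theorem prod_Ioc_zCoord (hx : ∀ i, x i ≠ 0) {i j : Fin n} (hij : i < j) :
    ∏ m ∈ Finset.Ioc i j, zCoord p x m = x j / x i := by
  refine prod_Ioc_eq_of_step (b := fun j => x j / x i) hij.le (div_self (hx i))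
    (fun _ => val_sub_one_add_one) fun m hm => ?_
  have h0 : m ≠ 0 := (lt_of_le_of_lt (Fin.zero_le i) hm).ne'
  rw [zCoord, if_neg h0, one_mul, div_mul_div_cancel₀ (hx _)]

theorem prod_compl_Ioc_zCoord (hx : ∀ i, x i ≠ 0) {i j : Fin n} (hij : i < j) :
    ∏ m ∈ (Finset.Ioc i j)ᶜ, zCoord p x m = p * x i / x j := by
  have h := Finset.prod_mul_prod_compl (Finset.Ioc i j) (zCoord p x)
  rw [prod_zCoord hx, prod_Ioc_zCoord hx hij] at h
  rw [eq_div_iff (hx j)]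
  have := hx i
  field_simp at h
  linear_combination h

/-- The expansions of the gamma factors converge to the elliptic gamma function. -/
theorem eventually_value_formalGamma (hq1 : ‖q‖ < 1) {c : ℂ} {i j : Fin n} (hij : i < j) :
    ∀ᶠ ρ in 𝓝[>] (0 : ℝ), ∀ (p : ℂ) (x : Fin n → ℂ), (∀ i, x i ≠ 0) →
      (∀ m, ‖zCoord p x m‖ ≤ ρ) →
      value (zCoord p x) (formalGamma q c i j) = ellipticGamma p q (c * (x j / x i)) := by
  filter_upwards [inv_gammaDenominator_mem_convergentGerms hq1 c hij,
    Ioo_mem_nhdsGT zero_lt_one] with ρ hD hρ p x hx hz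
  have hd := gammaDenominator_mem hq1 hρ.1 hρ.2 c i j
  rw [formalGamma_eq, value_mul hz (gammaNumerator_mem hq1 hρ.1 hρ.2 _ i j) hD,
    value_inv hz hd hD (by simp [constantCoeff_gammaDenominator hq1 c hij]), ellipticGamma,
    div_eq_mul_inv, gammaDenominator, gammaNumerator,
    value_doubleShiftedFactorial hq1 hρ.1 hρ.2 (C_mul_ratio_mem _ _ _ _) hz,
    value_doubleShiftedFactorial hq1 hρ.1 hρ.2 (C_mul_coratio_mem _ _ _ _) hz,
    ratio, coratio, value_C_mul_prod_X hz, value_C_mul_prod_X hz, prod_zCoord hx,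
    prod_Ioc_zCoord hx hij, prod_compl_Ioc_zCoord hx hij]
  congr 2
  rw [← div_div, div_div_eq_mul_div]
  ring

theorem eventually_value_formalReflectionFactor (hq1 : ‖q‖ < 1) (t : ℂ) :
    ∀ᶠ ρ in 𝓝[>] (0 : ℝ), ∀ (p : ℂ) (x : Fin n → ℂ), (∀ i, x i ≠ 0) →
      (∀ m, ‖zCoord p x m‖ ≤ ρ) →
      value (zCoord p x) (formalReflectionFactor n q t) = reflectionFactor p q t x := by
  have key : ∀ i j : Fin n, i < j → ∀ᶠ ρ in 𝓝[>] (0 : ℝ),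
      pairFactor q t i j ∈ convergentSubring n ρ ∧ ∀ (p : ℂ) (x : Fin n → ℂ),
        (∀ i, x i ≠ 0) → (∀ m, ‖zCoord p x m‖ ≤ ρ) →
        value (zCoord p x) (pairFactor q t i j) =
          ellipticGamma p q (t * x j / x i) / ellipticGamma p q (q * x j / (t * x i)) := by
    intro i j hij
    filter_upwards [formalGamma_mem_convergentGerms hq1 t hij,
      formalGamma_mem_convergentGerms hq1 (q / t) hij,
      inv_formalGamma_mem_convergentGerms hq1 (q / t) hij,
      eventually_value_formalGamma hq1 (c := t) hij,
      eventually_value_formalGamma hq1 (c := q / t) hij] with ρ h₁ h₂ h₃ h₄ h₅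
    refine ⟨Subring.mul_mem _ h₁ h₃, fun p x hx hz => ?_⟩
    rw [pairFactor, value_mul hz h₁ h₃,
      value_inv hz h₂ h₃ (by simp [constantCoeff_formalGamma hq1 _ hij]), h₄ p x hx hz,
      h₅ p x hx hz, ← div_eq_mul_inv, mul_div_assoc, div_mul_div_comm]
  have key' := eventually_all.2 fun i => eventually_all.2 fun j => eventually_all.2 (key i j)
  filter_upwards [key'] with ρ h p x hx hz
  have hmem : ∀ i j, j ∈ Finset.Ioi i → pairFactor q t i j ∈ convergentSubring n ρ :=
    fun i j hj => (h i j (Finset.mem_Ioi.1 hj)).1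
  rw [formalReflectionFactor_eq, value_prod hz _ _ fun i _ => Subring.prod_mem _ (hmem i),
    reflectionFactor]
  refine Finset.prod_congr rfl fun i _ => ?_
  rw [value_prod hz _ _ (hmem i)]
  exact Finset.prod_congr rfl fun j hj => (h i j (Finset.mem_Ioi.1 hj)).2 p x hx hz

theorem termAt_ofNome_diag (hx : ∀ i, x i ≠ 0) (g : PowerSeries ℂ) (m : ℕ) :
    termAt (ofNome n g) (zCoord p x) (diag n m) = PowerSeries.coeff m g * p ^ m := by
  rw [termAt, coeff_diag_ofNome]
  simp only [diag_apply]
  rw [Finset.prod_pow, prod_zCoord hx]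

theorem value_ofNome (hx : ∀ i, x i ≠ 0) (g : PowerSeries ℂ) :
    value (zCoord p x) (ofNome n g) = ∑' m, PowerSeries.coeff m g * p ^ m := by
  rw [value, ← diag_injective.tsum_eq]
  · exact tsum_congr fun m => termAt_ofNome_diag hx g m
  · intro k hk
    by_contra h
    refine hk ?_
    rw [termAt, coeff_ofNome_of_ne fun m hm => h ⟨m, hm.symm⟩, zero_mul]

end Values

end

end Ruijsenaars

open Ruijsenaars in
theorem theorem2p8 (n : ℕ) [NeZero n] (q : ℂ) (hq0 : q ≠ 0) (hq1 : ‖q‖ < 1)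
    (s : Fin n → ℂ) (hs0 : ∀ i, s i ≠ 0)
    (hs : ∀ i j : Fin n, i < j → ∀ m : ℤ, m ≠ 0 → s j / s i ≠ q ^ m) :
    ∃ γ : ℂ → PowerSeries ℂ,
      (∀ t : ℂ, t ≠ 0 → γ t * γ (q / t) = 1) ∧
      ∀ t : ℂ, t ≠ 0 → ∀ (f : Ruijsenaars.Series n) (ε : ℕ → PowerSeries ℂ),
        Ruijsenaars.IsRuijsenaarsFunction q t s f ε →
        -- the transform of `f` is a Ruijsenaars function for `q / t`, with the same eigenvalues
        Ruijsenaars.IsRuijsenaarsFunction q (q / t) s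
          (Ruijsenaars.ofNome n (γ t) * Ruijsenaars.formalReflectionFactor n q t * f) ε ∧
        -- and the Ruijsenaars function for `q / t` is this one
        ∀ (f' : Ruijsenaars.Series n) (ε' : ℕ → PowerSeries ℂ),
          Ruijsenaars.IsRuijsenaarsFunction q (q / t) s f' ε' →
          f' = Ruijsenaars.ofNome n (γ t) * Ruijsenaars.formalReflectionFactor n q t * f ∧
          (∀ r, 1 ≤ r → r ≤ n → ε' r = ε r) ∧
          -- the same identity between functions in the asymptotic domain, for convergent series
          (Ruijsenaars.IsConvergent f →
            ∃ σ : ℝ, 0 < σ ∧ σ < 1 ∧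
              ∀ (p : ℂ) (x : Fin n → ℂ), (∀ i, x i ≠ 0) →
                (∀ j, ‖Ruijsenaars.zCoord p x j‖ < σ) →
                Summable (fun k => ‖Ruijsenaars.termAt f (Ruijsenaars.zCoord p x) k‖) ∧
                Summable (fun k => ‖Ruijsenaars.termAt f' (Ruijsenaars.zCoord p x) k‖) ∧
                Summable (fun m => ‖PowerSeries.coeff m (γ t) * p ^ m‖) ∧
                ∑' k, Ruijsenaars.termAt f' (Ruijsenaars.zCoord p x) k =
                  (∑' m, PowerSeries.coeff m (γ t) * p ^ m) *
                    Ruijsenaars.reflectionFactor p q t x *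
                    ∑' k, Ruijsenaars.termAt f (Ruijsenaars.zCoord p x) k) := by
  refine ⟨normalization q s, fun t ht => normalization_mul hq0 hq1 hs0 hs ht,
    fun t ht f ε hf => ?_⟩
  have hγ := normalization_mul_diagonal hq0 hq1 hs0 hs hf
  have hR := isRuijsenaarsFunction_transform hq0 hq1 ht hf hγ
  refine ⟨hR, fun f' ε' hf' => ?_⟩
  obtain ⟨hfeq, hεeq⟩ := unique hq0 hq1 hs0 hs hR hf'
  refine ⟨hfeq, hεeq, fun hconv => ?_⟩
  have hfg := mem_convergentGerms_of_isConvergent hconv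
  have hFg := formalReflectionFactor_mem_convergentGerms (n := n) hq1 t
  have hc : MvPowerSeries.constantCoeff
      (ofNome n (diagonal (formalReflectionFactor n q t * f))) = 1 := by
    rw [constantCoeff_ofNome, PowerSeries.coeff_zero_eq_constantCoeff_apply,
      constantCoeff_diagonal_reflection hq1 hf]
  have hγg : ofNome n (normalization q s t) ∈ convergentGerms n := by
    rw [(MvPowerSeries.eq_inv_iff_mul_eq_one (by simp [hc])).2
      (show ofNome n (normalization q s t) *
        ofNome n (diagonal (formalReflectionFactor n q t * f)) = 1 by
          rw [← ofNome_mul, hγ, ofNome_one])]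
    exact inv_mem_convergentGerms
      (ofNome_diagonal_mem_convergentGerms (Subring.mul_mem _ hFg hfg)) hc
  obtain ⟨σ, ⟨⟨⟨hfσ, hFσ⟩, hγσ⟩, hval⟩, hσ⟩ := (((((mem_convergentGerms.1 hfg).and (mem_convergentGerms.1 hFg)).and
    (mem_convergentGerms.1 hγg)).and
    (eventually_value_formalReflectionFactor (n := n) hq1 t)).and
      (Ioo_mem_nhdsGT (zero_lt_one (α := ℝ)))).exists
  refine ⟨σ, hσ.1, hσ.2, fun p x hx hz => ?_⟩
  replace hz := fun j => (hz j).le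
  have hγF := Subring.mul_mem _ hγσ hFσ
  have hγs := (summable_norm_termAt hz hγσ).comp_injective (diag_injective (n := n))
  refine ⟨summable_norm_termAt hz hfσ, ?_, ?_, ?_⟩
  · rw [hfeq]
    exact summable_norm_termAt hz (Subring.mul_mem _ hγF hfσ)
  · simpa only [Function.comp_def, termAt_ofNome_diag hx] using hγs
  · rw [← value_ofNome hx, ← hval p x hx hz, hfeq]
    exact (value_mul hz hγF hfσ).trans (by rw [value_mul hz hγσ hFσ]; rfl)
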